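/- Setup (units with $\hbar=1$). Let $\mathcal H_S$ be a finite-dimensional complex Hilbert space, $A_S$ a Hermitian operator on it (the conserved quantity), and $U_S$ an arbitrary unitary operator on it. Put $A_S':=U_S^\dagger A_SU_S$ and $$\mathcal A_{U_S}:=\frac{\lambda_{\max}(A_S'-A_S)-\lambda_{\min}(A_S'-A_S)}{2},$$ where $\lambda_{\max},\lambda_{\min}$ are the largest and smallest eigenvalue, and let $\|A_S\|$ be the operator norm. An implementation set $\mathcal I=(\mathcal H_E,A_E,\rho_E,e^{-i\tau H_{SE}})$ consists of a Hilbert space $\mathcal H_E$, a (possibly unbounded) self-adjoint operator $A_E$ on $\mathcal H_E$, a density operator $\rho_E$ on $\mathcal H_E$, and a unitary evolution $e^{-i\tau H_{SE}}$, $\tau>0$, on $\mathcal H_S\otimes\mathcal H_E$ generated by a Hamiltonian with $[H_{SE},A_S\otimes 1+1\otimes A_E]=0$. It induces the channel $\Lambda_S(\rho)=\operatorname{Tr}_E[e^{-i\tau H_{SE}}(\rho\otimes\rho_E)e^{i\tau H_{SE}}]$. For a state $\rho$ of $S$ with purification $|\psi\rangle_{SR}$ and a channel $\Lambda$ on $S$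 let $$F_e(\rho,\Lambda)=\sqrt{\langle\psi|_{SR}\,[1_R\otimes\Lambda](|\psi\rangle\langle\psi|_{SR})\,|\psi\rangle_{SR}},\qquad L_e(\rho,\Lambda)=\sqrt{2(1-F_e(\rho,\Lambda))},$$ and define the error of $\mathcal I$ as $\delta_{\mathcal I}:=\max_{\rho}L_e(\rho,\Lambda_{U_S^\dagger}\circ\Lambda_S)$, where $\Lambda_{U_S^\dagger}(\rho)=U_S^\dagger\rho U_S$ and the maximum is over all states of $S$. The coherence of $\rho_E$ is its quantum Fisher information with respect to $A_E$, $$\mathcal F(\rho_E):=\min_{\{q_j,\phi_j\}:\ \rho_E=\sum_jq_j|\phi_j\rangle\langle\phi_j|}\ 4\sum_jq_jV_{A_E}(\phi_j)^2,\qquad V_{A_E}(\phi)^2=\langle\phi|A_E^2|\phi\rangle-\langle\phi|A_E|\phi\rangle^2 ,$$ the minimum being over all decompositions of $\rho_E$ into pure states $\phi_j$ with probabilities $q_j$. Theorem. Let $\delta$ be a real number with $0<\delta\le \dfrac{4\sqrt2\,\mathcal A_{U_S}}{9\|A_S\|}$ (where $A_S\ne0$). For every real number $\mathcal F\ge0$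 with $$\sqrt{\mathcal F}\ \ge\ \frac{\mathcal A_{U_S}}{\delta}+\sqrt2\,\|A_S\|$$ there exists an implementation set $\mathcal I$ with $\delta_{\mathcal I}\le\delta$ and $\mathcal F(\rho_E)=\mathcal F$. -/

import Mathlib

/-!
Finite-dimensional system `S`: its Hilbert space is `ℂⁿ = EuclideanSpace ℂ n` for a finite index
type `n`, operators on it are matrices. External system `E`: an arbitrary complex Hilbert space
`HE`. The composite space `ℂⁿ ⊗ HE` is the Hilbert sum `PiLp 2 (fun _ : n => HE)` of copies of
`HE`, where `e_i ⊗ x` is the family with entry `x` at `i` and `0` elsewhere. Units with `ħ = 1`.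
-/

noncomputable section

namespace CoherenceCost

open scoped ENNReal ComplexOrder

/-! ### The system `S`: asymmetry and norm -/

section System

variable {n : Type*} [Fintype n] [DecidableEq n]

/-- Largest eigenvalue of a Hermitian matrix. -/
def lambdaMax (X : Matrix n n ℂ) : ℝ := sSup (spectrum ℝ X)

/-- Smallest eigenvalue of a Hermitian matrix. -/
def lambdaMin (X : Matrix n n ℂ) : ℝ := sInf (spectrum ℝ X)

/-- The degree of asymmetry `(λ_max(A' - A) - λ_min(A' - A)) / 2`, with `A' = U† A U`. -/
def asymmetry (A U : Matrix n n ℂ) : ℝ :=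
  (lambdaMax (U.conjTranspose * A * U - A) - lambdaMin (U.conjTranspose * A * U - A)) / 2

/-- Operator norm of a matrix acting on the Hilbert space `ℂⁿ`. -/
def opNorm (A : Matrix n n ℂ) : ℝ := ‖Matrix.toEuclideanCLM (n := n) (𝕜 := ℂ) A‖

end System

/-! ### Density matrices, purifications, entanglement fidelity -/

section Fidelity

variable {n m : Type*} [Fintype n] [DecidableEq n] [Fintype m]

/-- The states of the system. -/
structure DensityMatrix (n : Type*) [Fintype n] where
  mat : Matrix n n ℂ
  posSemidef : mat.PosSemidef
  trace_eq_one : mat.trace = 1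

/-- `ψ ∈ ℂⁿ ⊗ ℂᵐ` is a purification of `ρ`: its partial trace over the reference is `ρ`. -/
def IsPurification (ψ : n × m → ℂ) (ρ : Matrix n n ℂ) : Prop :=
  ∀ i j, ∑ k, ψ (i, k) * star (ψ (j, k)) = ρ i j

/-- The map `1_R ⊗ Λ` on matrices over `S ⊗ R`; `Λ` acts on the blocks. -/
def applyOnSystem (Λ : Matrix n n ℂ → Matrix n n ℂ) (X : Matrix (n × m) (n × m) ℂ) :
    Matrix (n × m) (n × m) ℂ :=
  Matrix.of fun p q => Λ (Matrix.of fun a b => X (a, p.2) (b, q.2)) p.1 q.1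

/-- `√ ⟨ψ| (1_R ⊗ Λ)(|ψ⟩⟨ψ|) |ψ⟩`. -/
def pureFidelity (Λ : Matrix n n ℂ → Matrix n n ℂ) (ψ : n × m → ℂ) : ℝ :=
  Real.sqrt (star ψ ⬝ᵥ
    (applyOnSystem Λ (Matrix.vecMulVec ψ (star ψ))).mulVec ψ).re

/-- The purification `∑_l √p_l |ψ_l⟩ ⊗ |l⟩` of `ρ = ∑_l p_l |ψ_l⟩⟨ψ_l|`. -/
def purification (ρ : DensityMatrix n) : n × n → ℂ := fun q =>
  (ρ.posSemidef.isHermitian.eigenvectorUnitary : Matrix n n ℂ) q.1 q.2 *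
    (Real.sqrt (ρ.posSemidef.isHermitian.eigenvalues q.2) : ℂ)

theorem purification_isPurification (ρ : DensityMatrix n) :
    IsPurification (purification ρ) ρ.mat := by
  intro i j
  have h := ρ.posSemidef.isHermitian.spectral_theorem
  have hij := congrFun (congrFun h i) j
  rw [hij, Unitary.conjStarAlgAut_apply, Matrix.mul_apply]
  refine Finset.sum_congr rfl fun k _ => ?_
  have hk : ((Real.sqrt (ρ.posSemidef.isHermitian.eigenvalues k) : ℝ) : ℂ) *
      ((Real.sqrt (ρ.posSemidef.isHermitian.eigenvalues k) : ℝ) : ℂ) =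
      (ρ.posSemidef.isHermitian.eigenvalues k : ℂ) := by
    rw [← Complex.ofReal_mul, Real.mul_self_sqrt (ρ.posSemidef.eigenvalues_nonneg k)]
  rw [Matrix.mul_diagonal, Function.comp, Matrix.star_apply]
  simp only [purification, star_mul', Complex.star_def, Complex.conj_ofReal]
  simp only [Complex.coe_algebraMap, ← hk]
  ring

/-- For linear `Λ` the value does not depend on the purification. -/
theorem pureFidelity_eq (Λ : Matrix n n ℂ →ₗ[ℂ] Matrix n n ℂ) {ψ : n × m → ℂ}
    {ρ : Matrix n n ℂ} (h : IsPurification ψ ρ) :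
    pureFidelity Λ ψ = Real.sqrt
      (∑ i, ∑ j, ∑ a, ∑ b, ρ a i * ρ j b * Λ (Matrix.single a b 1) i j).re := by
  have key : ∀ (k l : m) (i j : n),
      Λ (Matrix.of fun a b => Matrix.vecMulVec ψ (star ψ) (a, k) (b, l)) i j =
      ∑ a, ∑ b, ψ (a, k) * star (ψ (b, l)) * Λ (Matrix.single a b 1) i j := by
    intro k l i j
    conv_lhs => rw [Matrix.matrix_eq_sum_single
      (Matrix.of fun a b => Matrix.vecMulVec ψ (star ψ) (a, k) (b, l))]
    simp only [map_sum, Matrix.sum_apply]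
    refine Finset.sum_congr rfl fun a _ => Finset.sum_congr rfl fun b _ => ?_
    have : Matrix.single a b ((Matrix.of fun a b =>
        Matrix.vecMulVec ψ (star ψ) (a, k) (b, l)) a b) =
        (ψ (a, k) * star (ψ (b, l))) • Matrix.single a b (1 : ℂ) := by
      simp [Matrix.vecMulVec_apply]
    rw [this, map_smul, Matrix.smul_apply, smul_eq_mul]
  unfold pureFidelity
  congr 2
  simp only [dotProduct, Matrix.mulVec, Fintype.sum_prod_type, applyOnSystem, Matrix.of_apply,
    Pi.star_apply]
  simp only [key, ← h _ _, Finset.mul_sum, Finset.sum_mul]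
  have e1 : ∀ f : n → m → n → m → n → n → ℂ,
      ∑ i, ∑ k, ∑ j, ∑ l, ∑ a, ∑ b, f i k j l a b =
      ∑ i, ∑ j, ∑ a, ∑ b, ∑ l, ∑ k, f i k j l a b := by
    intro f
    refine Finset.sum_congr rfl fun i _ => ?_
    rw [Finset.sum_comm]
    refine Finset.sum_congr rfl fun j _ => ?_
    rw [Finset.sum_comm, Finset.sum_congr rfl fun l _ => Finset.sum_comm, Finset.sum_comm]
    refine Finset.sum_congr rfl fun a _ => ?_
    rw [Finset.sum_congr rfl fun l _ => Finset.sum_comm, Finset.sum_comm]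
  rw [e1]
  refine Finset.sum_congr rfl fun i _ => Finset.sum_congr rfl fun j _ =>
    Finset.sum_congr rfl fun a _ => Finset.sum_congr rfl fun b _ =>
    Finset.sum_congr rfl fun l _ => Finset.sum_congr rfl fun k _ => ?_
  ring

/-- The entanglement fidelity `F_e(ρ, Λ)`. -/
def entanglementFidelity (ρ : DensityMatrix n) (Λ : Matrix n n ℂ → Matrix n n ℂ) : ℝ :=
  pureFidelity Λ (purification ρ)

/-- The entanglement Bures distance `L_e(ρ, Λ) = √(2 (1 - F_e(ρ, Λ)))`. -/
def entanglementBures (ρ : DensityMatrix n) (Λ : Matrix n n ℂ → Matrix n n ℂ) : ℝ :=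
  Real.sqrt (2 * (1 - entanglementFidelity ρ Λ))

theorem bddAbove_entanglementBures (Λ : Matrix n n ℂ → Matrix n n ℂ) :
    BddAbove (Set.range fun ρ : DensityMatrix n => entanglementBures ρ Λ) := by
  refine ⟨Real.sqrt 2, ?_⟩
  rintro _ ⟨ρ, rfl⟩
  refine Real.sqrt_le_sqrt ?_
  have : 0 ≤ entanglementFidelity ρ Λ := Real.sqrt_nonneg _
  linarith

end Fidelity

/-! ### The external system: states, trace, Fisher information -/

section External

variable {H : Type*} [NormedAddCommGroup H] [InnerProductSpace ℂ H] [CompleteSpace H]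

/-- A set of vectors underlying some Hilbert basis of `H`. -/
def basisSet (H : Type*) [NormedAddCommGroup H] [InnerProductSpace ℂ H] [CompleteSpace H] :
    Set H := (exists_hilbertBasis ℂ H).choose

/-- Some Hilbert basis of `H`. -/
def someBasis (H : Type*) [NormedAddCommGroup H] [InnerProductSpace ℂ H] [CompleteSpace H] :
    HilbertBasis (basisSet H) ℂ H := (exists_hilbertBasis ℂ H).choose_spec.choose

/-- The trace `∑_k ⟨e_k, T e_k⟩` (used for trace class `T`, where it converges and does not depend
on the basis). -/
def opTrace (T : H →L[ℂ] H) : ℂ := ∑' k, inner ℂ (someBasis H k) (T (someBasis H k))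

/-- Density operators: positive operators of trace one. -/
def IsDensityOperator (ρ : H →L[ℂ] H) : Prop :=
  ρ.IsPositive ∧ HasSum (fun k => inner ℂ (someBasis H k) (ρ (someBasis H k))) (1 : ℂ)

open Classical in
/-- The variance `V_A(φ)² = ⟨φ|A²|φ⟩ - ⟨φ|A|φ⟩²` of the self-adjoint operator `A` in the unit vector
`φ`, where `⟨φ|A²|φ⟩ = ‖A φ‖²`; it is infinite if `φ` is outside the domain of `A`. -/
def variance (A : H →ₗ.[ℂ] H) (φ : H) : ℝ≥0∞ :=
  if h : φ ∈ A.domain then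
    ENNReal.ofReal (‖A ⟨φ, h⟩‖ ^ 2 - (inner ℂ φ (A ⟨φ, h⟩)).re ^ 2)
  else ⊤

/-- `ρ = ∑_j q_j |φ_j⟩⟨φ_j|` with probabilities `q_j` and unit vectors `φ_j` (finite ensembles are
those with `q_j = 0` for large `j`). -/
structure IsEnsemble (ρ : H →L[ℂ] H) (q : ℕ → ℝ) (φ : ℕ → H) : Prop where
  nonneg : ∀ j, 0 ≤ q j
  hasSum_one : HasSum q 1
  norm_eq_one : ∀ j, ‖φ j‖ = 1
  hasSum : HasSum (fun j => (q j : ℂ) • InnerProductSpace.rankOne ℂ (φ j) (φ j)) ρ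

/-- The average `4 ∑_j q_j V_A(φ_j)²`. -/
def averageFluctuation (A : H →ₗ.[ℂ] H) (q : ℕ → ℝ) (φ : ℕ → H) : ℝ≥0∞ :=
  4 * ∑' j, ENNReal.ofReal (q j) * variance A (φ j)

/-- `F` is the quantum Fisher information of `ρ` with respect to `A`: the minimum of
`4 ∑_j q_j V_A(φ_j)²` over all decompositions `ρ = ∑_j q_j |φ_j⟩⟨φ_j|`. -/
def IsFisherInformation (A : H →ₗ.[ℂ] H) (ρ : H →L[ℂ] H) (F : ℝ≥0∞) : Prop :=
  IsLeast {c | ∃ q φ, IsEnsemble ρ q φ ∧ c = averageFluctuation A q φ} F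

end External

/-! ### The composite system -/

section Composite

variable {n : Type*} [Fintype n]
variable {H : Type*} [NormedAddCommGroup H] [InnerProductSpace ℂ H]

/-- `ℂⁿ ⊗ H`, as the Hilbert sum of copies of `H`. -/
def Composite (n : Type*) (H : Type*) := PiLp 2 (fun _ : n => H)

instance : NormedAddCommGroup (Composite n H) :=
  inferInstanceAs (NormedAddCommGroup (PiLp 2 (fun _ : n => H)))

instance : InnerProductSpace ℂ (Composite n H) :=
  inferInstanceAs (InnerProductSpace ℂ (PiLp 2 (fun _ : n => H)))

instance [CompleteSpace H] : CompleteSpace (Composite n H) :=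
  inferInstanceAs (CompleteSpace (PiLp 2 (fun _ : n => H)))

/-- The `i`-th component, i.e. the operator `⟨e_i| ⊗ 1`. -/
def coord (i : n) : Composite n H →L[ℂ] H := PiLp.proj 2 (fun _ : n => H) i

theorem composite_ext {ψ φ : Composite n H} (h : ∀ i, coord i ψ = coord i φ) : ψ = φ :=
  PiLp.ext h

theorem inner_composite (ψ φ : Composite n H) :
    inner ℂ ψ φ = ∑ i, inner ℂ (coord i ψ) (coord i φ) := rfl

variable [DecidableEq n]

/-- The operator `x ↦ e_j ⊗ x`. -/
def inj (j : n) : H →L[ℂ] Composite n H :=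
  ((PiLp.continuousLinearEquiv 2 ℂ (fun _ : n => H)).symm : (n → H) →L[ℂ] PiLp 2 (fun _ : n => H)) ∘L
    ContinuousLinearMap.single ℂ (fun _ : n => H) j

theorem coord_inj (i j : n) (x : H) : coord i (inj j x) = if i = j then x else 0 := by
  change (Pi.single j x : n → H) i = _
  rw [Pi.single_apply]

/-- The tensor product `M ⊗ T`. -/
def tensorOp (M : Matrix n n ℂ) (T : H →L[ℂ] H) : Composite n H →L[ℂ] Composite n H :=
  ∑ i, ∑ j, M i j • (inj i ∘L T ∘L coord j)

/-- The partial trace over the second factor. -/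
def partialTrace [CompleteSpace H] (X : Composite n H →L[ℂ] Composite n H) : Matrix n n ℂ :=
  Matrix.of fun i j => opTrace (coord i ∘L X ∘L inj j)

/-- The operator `A_S ⊗ 1 + 1 ⊗ A_E` with domain `ℂⁿ ⊗ dom A_E`. -/
def totalCharge (AS : Matrix n n ℂ) (AE : H →ₗ.[ℂ] H) :
    Composite n H →ₗ.[ℂ] Composite n H where
  domain :=
    { carrier := {ψ | ∀ i, coord i ψ ∈ AE.domain}
      add_mem' := fun {x y} hx hy i => by
        rw [map_add]; exact AE.domain.add_mem (hx i) (hy i)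
      zero_mem' := fun i => by rw [map_zero]; exact AE.domain.zero_mem
      smul_mem' := fun c x hx i => by
        rw [map_smul]; exact AE.domain.smul_mem c (hx i) }
  toFun :=
    { toFun := fun ψ => ∑ i, inj i ((∑ j, AS i j • coord j (ψ : Composite n H)) +
        AE ⟨coord i (ψ : Composite n H), ψ.2 i⟩)
      map_add' := by
        intro x y
        rw [← Finset.sum_add_distrib]
        refine Finset.sum_congr rfl fun i _ => ?_
        rw [← map_add]
        congr 1
        rw [add_add_add_comm, ← LinearPMap.map_add, ← Finset.sum_add_distrib]
        congr 1
        · simp only [Submodule.coe_add, map_add, smul_add]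
      map_smul' := by
        intro c x
        rw [RingHom.id_apply, Finset.smul_sum]
        refine Finset.sum_congr rfl fun i _ => ?_
        rw [← map_smul]
        congr 1
        rw [smul_add, ← LinearPMap.map_smul, Finset.smul_sum]
        congr 1
        · simp only [Submodule.coe_smul, map_smul, smul_comm c] }

theorem coord_totalCharge (AS : Matrix n n ℂ) (AE : H →ₗ.[ℂ] H)
    (ψ : (totalCharge AS AE).domain) (i : n) :
    coord i (totalCharge AS AE ψ) = (∑ j, AS i j • coord j (ψ : Composite n H)) +
      AE ⟨coord i (ψ : Composite n H), ψ.2 i⟩ := by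
  change coord i (∑ k, inj k ((∑ j, AS k j • coord j (ψ : Composite n H)) +
        AE ⟨coord k (ψ : Composite n H), ψ.2 k⟩)) = _
  simp only [map_sum, coord_inj, Finset.sum_ite_eq, Finset.mem_univ, if_true]

/-- `[B, T] = 0` for a bounded operator `B` and a densely defined operator `T`: `B` maps the domain
of `T` to itself and `T B = B T` there. -/
def CommutesWith {K : Type*} [NormedAddCommGroup K] [InnerProductSpace ℂ K]
    (B : K →L[ℂ] K) (T : K →ₗ.[ℂ] K) : Prop :=
  ∀ x : T.domain, ∃ h : B x ∈ T.domain, T ⟨B x, h⟩ = B (T x)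

end Composite

/-! ### Implementation sets -/

/-- An implementation set `(H_E, A_E, ρ_E, e^{-iτH})` for a system with conserved quantity `AS`:
`A_E` is a possibly unbounded self-adjoint operator, `ρ_E` a state, and the evolution is generated
during a time `τ` by a Hamiltonian `H` of the composite system with `[H, A_S + A_E] = 0`.
Bounded Hamiltonians suffice: a unitary operator that commutes with `A_S + A_E` is the exponential
of such an `H`. -/
structure ImplementationSet {n : Type*} [Fintype n] [DecidableEq n] (AS : Matrix n n ℂ) where
  HE : Type
  [normed : NormedAddCommGroup HE]
  [innerProduct : InnerProductSpace ℂ HE]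
  [complete : CompleteSpace HE]
  AE : HE →ₗ.[ℂ] HE
  dense_domain : Dense (AE.domain : Set HE)
  selfAdjoint : IsSelfAdjoint AE
  ρE : HE →L[ℂ] HE
  isDensityOperator : IsDensityOperator ρE
  /-- The evolution operator of the composite system. -/
  U : Composite n HE →L[ℂ] Composite n HE
  generated : ∃ (τ : ℝ) (H : Composite n HE →L[ℂ] Composite n HE), 0 < τ ∧ IsSelfAdjoint H ∧
    CommutesWith H (totalCharge AS AE) ∧ U = NormedSpace.exp ((-(Complex.I * (τ : ℂ))) • H)

attribute [instance] ImplementationSet.normed ImplementationSet.innerProduct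
  ImplementationSet.complete

namespace ImplementationSet

variable {n : Type*} [Fintype n] [DecidableEq n] {AS : Matrix n n ℂ}

/-- The channel `Λ_S(ρ) = Tr_E[U (ρ ⊗ ρ_E) U†]`. -/
def channel (I : ImplementationSet AS) (ρ : Matrix n n ℂ) : Matrix n n ℂ :=
  partialTrace (I.U ∘L tensorOp ρ I.ρE ∘L ContinuousLinearMap.adjoint I.U)

/-- The error `δ(ρ) = L_e(ρ, Λ_{U_S†} ∘ Λ_S)` at the initial state `ρ`. -/
def errorAt (I : ImplementationSet AS) (US : Matrix n n ℂ) (ρ : DensityMatrix n) : ℝ :=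
  entanglementBures ρ fun X => US.conjTranspose * I.channel X * US

/-- The error of the implementation: the largest `δ(ρ)` over all states `ρ` of the system. -/
def error (I : ImplementationSet AS) (US : Matrix n n ℂ) : ℝ :=
  ⨆ ρ : DensityMatrix n, I.errorAt US ρ

end ImplementationSet

end CoherenceCost

end

/-! The environment is `L²(ℝ)` with position as its charge, so translation by `s` raises the charge
by `s`. Write `AS = ∑ a_k P_k`. Tensoring the block `P_k US P_l` with the translation `T` by `a_l -
a_k` hands to the environment exactly the charge that the system loses. The resulting operator is
`W† (US ⊗ 1) W` with `W = ∑ P_k ⊗ T_{a_k}`. Since `M ↦ W† (M ⊗ 1) W` is an algebra homomorphism into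
charge-conserving operators, it also carries a logarithm of `US` to a conserving Hamiltonian
(`exists_covariantExtension_eq_exp`).

The environment starts in a pure Gaussian `g` of position variance `v = F / 4`, whose Fisher
information is `4 v = F`. Put `Q_k = US† P_k US`. After undoing `US`, the entanglement fidelity is
the norm of `∑ tr(ρ Q_k P_l) T_{a_l - a_k} g` (`entanglementFidelity_gramChannel`), hence at least
the real part of its inner product with `T_{-c} g`, for any real `c`. Gaussian overlaps are values
of the characteristic function of the momentum distribution `N(0, 1/(4v))`, so this inner product is
the average over `p` of `tr(ρ e^{-ipB} e^{ipA})`, where `A = AS` and `B = US† AS US - c`. The real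
part of the integrand is at least `1 - ‖B - A‖² p² / 2` (`IsSpectralFamily.one_sub_le_re_sum`). With
`c` the midpoint of the spectrum of `US† AS US - AS`, the norm is at most the asymmetry `𝒜`.
Averaging gives fidelity at least `1 - 𝒜² / (8v)`, that is, error at most `𝒜 / √F ≤ δ`. -/

open MeasureTheory ProbabilityTheory

noncomputable section

namespace CoherenceCost

/-! ### The position operator and the translations on `L²(ℝ)` -/

section Line

/-- The Hilbert space `L²(ℝ)`. -/
abbrev LineL2 : Type := Lp ℂ 2 (volume : Measure ℝ)

/-- Multiplication by `x` on `L²(ℝ)`, with its maximal domain. -/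
def position : LineL2 →ₗ.[ℂ] LineL2 where
  domain :=
    { carrier := {f | MemLp (fun x : ℝ => (x : ℂ) * f x) 2 volume}
      add_mem' := fun {f g} hf hg => by
        refine (memLp_congr_ae ?_).1 (hf.add hg)
        filter_upwards [Lp.coeFn_add f g] with x hx
        rw [hx]
        exact (mul_add _ _ _).symm
      zero_mem' := by
        refine (memLp_congr_ae ?_).1 (MemLp.zero (ε := ℂ))
        filter_upwards [Lp.coeFn_zero ℂ 2 (volume : Measure ℝ)] with x hx
        simp
      smul_mem' := fun c f hf => by
        refine (memLp_congr_ae ?_).1 (hf.const_smul c)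
        filter_upwards [Lp.coeFn_smul c f] with x hx
        simp [hx, mul_left_comm] }
  toFun :=
    { toFun := fun f => MemLp.toLp _ f.2
      map_add' := fun f g => by
        rw [← MemLp.toLp_add, MemLp.toLp_eq_toLp_iff]
        filter_upwards [Lp.coeFn_add (f : LineL2) g] with x hx
        rw [Submodule.coe_add, hx]
        exact mul_add _ _ _
      map_smul' := fun c f => by
        rw [RingHom.id_apply, ← MemLp.toLp_const_smul, MemLp.toLp_eq_toLp_iff]
        filter_upwards [Lp.coeFn_smul c (f : LineL2)] with x hx
        simp [hx, mul_left_comm] }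

theorem coeFn_position (f : position.domain) :
    (position f : LineL2) =ᵐ[volume] fun x : ℝ => (x : ℂ) * (f : LineL2) x :=
  MemLp.coeFn_toLp f.2

theorem memLp_indicator_mul {g : ℝ → ℂ} (hg : MemLp g 2 volume) (N : ℝ) :
    MemLp ((Set.Icc (-N) N).indicator fun x : ℝ => (x : ℂ) * g x) 2 volume := by
  refine hg.of_le_mul (c := |N|) ?_ (Filter.Eventually.of_forall fun x => ?_)
  · exact (Complex.measurable_ofReal.aestronglyMeasurable.mul
      hg.aestronglyMeasurable).indicator measurableSet_Icc
  · by_cases hx : x ∈ Set.Icc (-N) N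
    · rw [Set.indicator_of_mem hx, norm_mul, Complex.norm_real, Real.norm_eq_abs]
      exact mul_le_mul_of_nonneg_right ((abs_le.2 hx).trans (le_abs_self N)) (norm_nonneg _)
    · rw [Set.indicator_of_notMem hx, norm_zero]
      positivity

/-- The difference `x g - h` cut off to `[-N, N]` lies in the domain, and testing the hypothesis on
it gives its squared norm, which therefore vanishes. The case `g = 0` yields density of the domain,
the general case self-adjointness. -/
theorem ae_eq_of_forall_inner_eq {g h : LineL2}
    (H : ∀ f : position.domain, inner ℂ h (f : LineL2) = inner ℂ g (position f)) :
    (fun x : ℝ => (x : ℂ) * g x) =ᵐ[volume] h := by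
  have key : ∀ N : ℕ, ∀ᵐ x : ℝ, x ∈ Set.Icc (-(N : ℝ)) N → (x : ℂ) * g x = h x := by
    intro N
    set S : Set ℝ := Set.Icc (-(N : ℝ)) N
    have hr : MemLp (S.indicator fun x : ℝ => (x : ℂ) * g x - h x) 2 volume := by
      have := (memLp_indicator_mul (Lp.memLp g) N).sub
        ((Lp.memLp h).indicator (s := S) measurableSet_Icc)
      rwa [← Set.indicator_sub'] at this
    have hmem : hr.toLp ∈ position.domain := by
      refine (memLp_congr_ae ?_).1 (memLp_indicator_mul hr N)
      filter_upwards [hr.coeFn_toLp] with x hx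
      rw [hx]
      by_cases hS : x ∈ S
      · rw [Set.indicator_of_mem hS]
      · rw [Set.indicator_of_notMem hS, Set.indicator_of_notMem hS, mul_zero]
    have h0 : inner ℂ hr.toLp hr.toLp = 0 := by
      have e := H ⟨_, hmem⟩
      rw [L2.inner_def, L2.inner_def] at e
      rw [L2.inner_def, ← sub_eq_zero.2 e.symm, ← integral_sub (L2.integrable_inner _ _)
        (L2.integrable_inner _ _)]
      refine integral_congr_ae ?_
      filter_upwards [hr.coeFn_toLp, coeFn_position ⟨_, hmem⟩] with x h1 h2
      simp only [h1, h2]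
      by_cases hS : x ∈ S
      · rw [Set.indicator_of_mem hS]
        simp only [RCLike.inner_apply, map_sub, map_mul, Complex.conj_ofReal]
        ring
      · simp [Set.indicator_of_notMem hS]
    have h1 := inner_self_eq_zero.1 h0
    filter_upwards [hr.coeFn_toLp, Lp.coeFn_zero ℂ 2 (volume : Measure ℝ)] with x h2 h3 hS
    rw [h1, h3, Set.indicator_of_mem hS] at h2
    exact (sub_eq_zero.1 h2.symm)
  filter_upwards [ae_all_iff.2 key] with x hx
  obtain ⟨N, hN⟩ := exists_nat_ge |x|
  exact hx N (abs_le.1 hN)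

theorem dense_position_domain : Dense (position.domain : Set LineL2) := by
  rw [Submodule.dense_iff_topologicalClosure_eq_top, Submodule.topologicalClosure_eq_top_iff,
    Submodule.eq_bot_iff]
  intro g hg
  have := ae_eq_of_forall_inner_eq (g := 0) (h := g) fun f => by
    rw [inner_zero_left, Submodule.inner_left_of_mem_orthogonal f.2 hg]
  refine Lp.ext ?_
  filter_upwards [this, Lp.coeFn_zero ℂ 2 (volume : Measure ℝ)] with x h1 h2
  rw [← h1, h2, Pi.zero_apply, mul_zero]

theorem position_isFormalAdjoint : position.IsFormalAdjoint position := by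
  intro f g
  rw [L2.inner_def, L2.inner_def]
  refine integral_congr_ae ?_
  filter_upwards [coeFn_position f, coeFn_position g] with x h1 h2
  simp only [h1, h2, RCLike.inner_apply, map_mul, Complex.conj_ofReal]
  ring

theorem position_isSelfAdjoint : IsSelfAdjoint position := by
  rw [LinearPMap.isSelfAdjoint_def]
  have hle := position_isFormalAdjoint.le_adjoint dense_position_domain
  -- Symmetry gives one inclusion. For `g` in the adjoint domain, `x g` agrees almost everywhere
  -- with an `L²` function, so `g` is already in the maximal domain.
  refine (LinearPMap.eq_of_le_of_domain_eq hle (le_antisymm hle.1 fun g hg => ?_)).symm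
  have h := ae_eq_of_forall_inner_eq (g := g) (h := position.adjoint ⟨g, hg⟩) fun f =>
    position.adjoint_isFormalAdjoint dense_position_domain ⟨g, hg⟩ f
  exact (memLp_congr_ae h).2 (Lp.memLp _)

/-- The translation `f ↦ f (· - s)`. -/
def translation (s : ℝ) : LineL2 →L[ℂ] LineL2 :=
  (Lp.compMeasurePreservingₗᵢ ℂ (fun x : ℝ => x - s)
    (measurePreserving_sub_right volume s)).toContinuousLinearMap

theorem coeFn_translation (s : ℝ) (f : LineL2) :
    translation s f =ᵐ[volume] fun x => f (x - s) :=
  Lp.coeFn_compMeasurePreserving f (measurePreserving_sub_right volume s)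

theorem translation_toLp (s : ℝ) {g : ℝ → ℂ} (hg : MemLp g 2 volume) :
    translation s hg.toLp =ᵐ[volume] fun x => g (x - s) := by
  filter_upwards [coeFn_translation s hg.toLp,
    (measurePreserving_sub_right volume s).quasiMeasurePreserving.ae_eq_comp hg.coeFn_toLp]
    with x h1 h2
  exact h1.trans h2

theorem translation_zero : translation 0 = 1 := by
  ext1 f
  refine Lp.ext ?_
  filter_upwards [coeFn_translation 0 f] with x hx
  rw [hx, sub_zero, one_apply_eq_self]

theorem translation_add (s t : ℝ) : translation (s + t) = translation s * translation t := by
  ext1 f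
  refine Lp.ext ?_
  filter_upwards [coeFn_translation (s + t) f, coeFn_translation s (translation t f),
    (measurePreserving_sub_right volume s).quasiMeasurePreserving.ae_eq_comp
      (coeFn_translation t f)] with x h1 h2 h3
  rw [h1, mul_apply_eq_comp, h2]
  refine Eq.trans ?_ h3.symm
  simp only [Function.comp, sub_sub]

theorem norm_translation (s : ℝ) (f : LineL2) : ‖translation s f‖ = ‖f‖ :=
  LinearIsometry.norm_map (Lp.compMeasurePreservingₗᵢ ℂ (fun x : ℝ => x - s)
    (measurePreserving_sub_right volume s)) f

theorem inner_translation (s : ℝ) (f g : LineL2) :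
    inner ℂ (translation s f) (translation s g) = inner ℂ f g :=
  LinearIsometry.inner_map_map (Lp.compMeasurePreservingₗᵢ ℂ (fun x : ℝ => x - s)
    (measurePreserving_sub_right volume s)) f g

theorem adjoint_translation (s : ℝ) :
    ContinuousLinearMap.adjoint (translation s) = translation (-s) := by
  symm
  rw [ContinuousLinearMap.eq_adjoint_iff]
  intro f g
  rw [← inner_translation s, ← mul_apply_eq_comp, ← translation_add, add_neg_cancel,
    translation_zero, one_apply_eq_self]

/-- This is `x f(x - s) = (x - s) f(x - s) + s f(x - s)`. -/
theorem position_translation (s : ℝ) (f : position.domain) :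
    ∃ h : translation s f ∈ position.domain,
      position ⟨translation s f, h⟩ = translation s (position f) + (s : ℂ) • translation s f := by
  have hae : (translation s (position f) + (s : ℂ) • translation s f : LineL2) =ᵐ[volume]
      fun x : ℝ => (x : ℂ) * translation s f x := by
    filter_upwards [Lp.coeFn_add (translation s (position f)) ((s : ℂ) • translation s f),
      Lp.coeFn_smul (s : ℂ) (translation s f), coeFn_translation s f,
      coeFn_translation s (position f),
      (measurePreserving_sub_right volume s).quasiMeasurePreserving.ae_eq_comp
        (coeFn_position f)] with x h1 h2 h3 h4 h5
    simp only [Function.comp] at h5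
    rw [h1, Pi.add_apply, h2, Pi.smul_apply, h4, h5, h3, smul_eq_mul]
    push_cast
    ring
  have hmem : translation s f ∈ position.domain :=
    (memLp_congr_ae hae).1 (Lp.memLp _)
  exact ⟨hmem, Lp.ext ((coeFn_position ⟨_, hmem⟩).trans hae.symm)⟩

end Line

end CoherenceCost

end

open MeasureTheory ProbabilityTheory

noncomputable section

namespace CoherenceCost

open scoped ENNReal NNReal

/-! ### Gaussian wave functions -/

section Gaussian

variable {v : ℝ≥0}

/-- Completing the square: `(x - s)² + (x - t)² = 2 (x - (s + t)/2)² + (s - t)²/2`. -/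
theorem sqrt_gaussianPDFReal_mul (hv : v ≠ 0) (s t x : ℝ) :
    √(gaussianPDFReal 0 v (x - s)) * √(gaussianPDFReal 0 v (x - t)) =
      Real.exp (-(s - t) ^ 2 / (8 * v)) * gaussianPDFReal ((s + t) / 2) v x := by
  have hv' : (v : ℝ) ≠ 0 := by exact_mod_cast hv
  rw [← Real.sqrt_mul (gaussianPDFReal_nonneg _ _ _), Real.sqrt_eq_iff_mul_self_eq
    (mul_nonneg (gaussianPDFReal_nonneg _ _ _) (gaussianPDFReal_nonneg _ _ _))
    (mul_nonneg (Real.exp_nonneg _) (gaussianPDFReal_nonneg _ _ _))]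
  simp only [gaussianPDFReal]
  -- Strips the common normalizing constant `c`, leaving an identity between exponents.
  have h : ∀ c a b d e : ℝ, Real.exp (d + d + (e + e)) = Real.exp (a + b) →
      Real.exp d * (c * Real.exp e) * (Real.exp d * (c * Real.exp e)) =
        c * Real.exp a * (c * Real.exp b) := by
    intro c a b d e h
    rw [Real.exp_add, Real.exp_add, Real.exp_add, Real.exp_add] at h
    linear_combination c ^ 2 * h
  refine (h _ _ _ _ _ ?_).symm
  congr 1
  field_simp
  ring

theorem memLp_sqrt_gaussianPDFReal (v : ℝ≥0) :
    MemLp (fun x => (√(gaussianPDFReal 0 v x) : ℂ)) 2 volume := by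
  have hm : Measurable fun x => (√(gaussianPDFReal 0 v x) : ℂ) :=
    Complex.measurable_ofReal.comp (measurable_gaussianPDFReal 0 v).sqrt
  rw [memLp_two_iff_integrable_sq_norm hm.aestronglyMeasurable]
  refine (integrable_gaussianPDFReal 0 v).congr (Filter.Eventually.of_forall fun x => ?_)
  simp only [Complex.norm_real, Real.norm_eq_abs, sq_abs]
  exact (Real.sq_sqrt (gaussianPDFReal_nonneg _ _ _)).symm

/-- The vector of `L²(ℝ)` with amplitude the square root of the density of `N(0, v)`. -/
def gaussianVector (v : ℝ≥0) : LineL2 := (memLp_sqrt_gaussianPDFReal v).toLp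

theorem inner_translation_gaussianVector (hv : v ≠ 0) (s t : ℝ) :
    inner ℂ (translation s (gaussianVector v)) (translation t (gaussianVector v)) =
      (Real.exp (-(s - t) ^ 2 / (8 * v)) : ℂ) := by
  rw [L2.inner_def]
  have h : (fun x => inner ℂ (translation s (gaussianVector v) x)
      (translation t (gaussianVector v) x)) =ᵐ[volume] fun x =>
      ((Real.exp (-(s - t) ^ 2 / (8 * v)) * gaussianPDFReal ((s + t) / 2) v x : ℝ) : ℂ) := by
    filter_upwards [translation_toLp s (memLp_sqrt_gaussianPDFReal v),
      translation_toLp t (memLp_sqrt_gaussianPDFReal v)] with x h1 h2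
    rw [gaussianVector, h1, h2, RCLike.inner_apply, Complex.conj_ofReal, ← Complex.ofReal_mul,
      mul_comm, sqrt_gaussianPDFReal_mul hv]
  rw [integral_congr_ae h, integral_complex_ofReal, integral_const_mul,
    integral_gaussianPDFReal_eq_one _ hv, mul_one]

theorem norm_gaussianVector (hv : v ≠ 0) : ‖gaussianVector v‖ = 1 := by
  have h := inner_translation_gaussianVector hv 0 0
  have h' : ‖gaussianVector v‖ ^ 2 = 1 := by
    rw [norm_sq_eq_re_inner (𝕜 := ℂ), ← inner_translation 0, h]
    simp
  exact (pow_eq_one_iff_of_nonneg (norm_nonneg _) two_ne_zero).1 h'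

theorem gaussianVector_mem_domain (hv : v ≠ 0) : gaussianVector v ∈ position.domain := by
  have hae : (fun x : ℝ => (x : ℂ) * gaussianVector v x) =ᵐ[volume]
      fun x : ℝ => (x : ℂ) * (√(gaussianPDFReal 0 v x) : ℂ) := by
    filter_upwards [(memLp_sqrt_gaussianPDFReal v).coeFn_toLp] with x hx
    rw [gaussianVector, hx]
  refine (memLp_congr_ae hae).2 ?_
  have hm : Measurable fun x : ℝ => (x : ℂ) * (√(gaussianPDFReal 0 v x) : ℂ) :=
    Complex.measurable_ofReal.mul
      (Complex.measurable_ofReal.comp (measurable_gaussianPDFReal 0 v).sqrt)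
  rw [memLp_two_iff_integrable_sq_norm hm.aestronglyMeasurable]
  have h := (memLp_id_gaussianReal (μ := 0) (v := v) 2).integrable_sq
  rw [gaussianReal_of_var_ne_zero 0 hv, integrable_withDensity_iff (measurable_gaussianPDF _ _)
    (Filter.Eventually.of_forall fun _ => gaussianPDF_lt_top)] at h
  refine h.congr (Filter.Eventually.of_forall fun x => ?_)
  simp only [norm_mul, Complex.norm_real, Real.norm_eq_abs, mul_pow, sq_abs, id,
    toReal_gaussianPDF]
  rw [Real.sq_sqrt (gaussianPDFReal_nonneg _ _ _)]

theorem variance_gaussianVector (hv : v ≠ 0) :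
    variance position (gaussianVector v) = (v : ℝ≥0∞) := by
  have hmem := gaussianVector_mem_domain hv
  have hpos : position ⟨_, hmem⟩ =ᵐ[volume]
      fun x : ℝ => (x : ℂ) * (√(gaussianPDFReal 0 v x) : ℂ) := by
    filter_upwards [coeFn_position ⟨_, hmem⟩, (memLp_sqrt_gaussianPDFReal v).coeFn_toLp]
      with x h1 h2
    rw [h1]
    exact congrArg _ h2
  have h1 : inner ℂ (gaussianVector v) (position ⟨_, hmem⟩) = 0 := by
    have h := integral_id_gaussianReal (μ := 0) (v := v)
    rw [integral_gaussianReal_eq_integral_smul hv] at h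
    rw [L2.inner_def, ← Complex.ofReal_zero, ← h, ← integral_complex_ofReal]
    refine integral_congr_ae ?_
    filter_upwards [hpos, (memLp_sqrt_gaussianPDFReal v).coeFn_toLp] with x h1 h2
    have h2' : gaussianVector v x = (√(gaussianPDFReal 0 v x) : ℂ) := h2
    rw [h2', h1, RCLike.inner_apply, Complex.conj_ofReal,
      mul_assoc, ← Complex.ofReal_mul, Real.mul_self_sqrt (gaussianPDFReal_nonneg _ _ _),
      ← Complex.ofReal_mul, smul_eq_mul, mul_comm]
  have h2 : inner ℂ (position ⟨_, hmem⟩) (position ⟨_, hmem⟩) = ((v : ℝ) : ℂ) := by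
    have h := variance_id_gaussianReal (μ := 0) (v := v)
    rw [variance_eq_integral aemeasurable_id] at h
    simp only [id, integral_id_gaussianReal, sub_zero] at h
    rw [integral_gaussianReal_eq_integral_smul hv] at h
    rw [L2.inner_def, ← h, ← integral_complex_ofReal]
    refine integral_congr_ae ?_
    filter_upwards [hpos] with x h1
    rw [h1, RCLike.inner_apply, map_mul, Complex.conj_ofReal, Complex.conj_ofReal,
      mul_mul_mul_comm, ← Complex.ofReal_mul, ← Complex.ofReal_mul,
      Real.mul_self_sqrt (gaussianPDFReal_nonneg _ _ _),
      ← Complex.ofReal_mul, smul_eq_mul, mul_comm, sq]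
  have h3 : ‖position ⟨_, hmem⟩‖ ^ 2 = (v : ℝ) := by
    rw [norm_sq_eq_re_inner (𝕜 := ℂ), h2]
    rfl
  rw [variance, dif_pos hmem, h1, h3]
  simp

end Gaussian

/-! ### Fisher information of pure states -/

section Pure

variable {H : Type*} [NormedAddCommGroup H] [InnerProductSpace ℂ H]

theorem variance_smul (A : H →ₗ.[ℂ] H) {c : ℂ} (hc : ‖c‖ = 1) (φ : H) :
    variance A (c • φ) = variance A φ := by
  have hc0 : c ≠ 0 := by
    rintro rfl
    simp at hc
  unfold variance
  by_cases h : φ ∈ A.domain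
  · have h' : c • φ ∈ A.domain := A.domain.smul_mem c h
    have e : A ⟨c • φ, h'⟩ = c • A ⟨φ, h⟩ := A.map_smul c ⟨φ, h⟩
    rw [dif_pos h, dif_pos h', e, norm_smul, hc, one_mul, inner_smul_left, inner_smul_right,
      ← mul_assoc, Complex.conj_mul', hc]
    simp
  · rw [dif_neg h, dif_neg]
    exact fun h' => h ((A.domain.smul_mem_iff hc0).1 h')

/-- For `w ⟂ φ`, the expectation of the projection in `w` is `∑ q_k |⟨ψ_k, w⟩|² = 0`, so every
vector of positive weight is orthogonal to `w`. Taking for `w` the component of `ψ_j` orthogonal to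
`φ` shows that this component vanishes. -/
theorem IsEnsemble.exists_eq_smul {φ : H} (hφ : ‖φ‖ = 1) {q : ℕ → ℝ} {ψ : ℕ → H}
    (h : IsEnsemble (InnerProductSpace.rankOne ℂ φ φ) q ψ) {j : ℕ} (hj : q j ≠ 0) :
    ∃ c : ℂ, ‖c‖ = 1 ∧ ψ j = c • φ := by
  have hφφ : inner ℂ φ φ = 1 := by rw [inner_self_eq_norm_sq_to_K, hφ]; simp
  have horth : ∀ w : H, inner ℂ φ w = 0 → inner ℂ (ψ j) w = 0 := by
    intro w hw
    have h1 : HasSum (fun k => inner ℂ w ((q k : ℂ) • inner ℂ (ψ k) w • ψ k))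
        (inner ℂ w (inner ℂ φ w • φ)) :=
      (h.hasSum.mapL (ContinuousLinearMap.apply ℂ H w)).mapL (innerSL ℂ w)
    rw [hw, zero_smul, inner_zero_right, ← Complex.ofReal_zero] at h1
    have h2 : HasSum (fun k => q k * ‖inner ℂ (ψ k) w‖ ^ 2) 0 := by
      have e : ∀ k, inner ℂ w ((q k : ℂ) • inner ℂ (ψ k) w • ψ k) =
          ((q k * ‖inner ℂ (ψ k) w‖ ^ 2 : ℝ) : ℂ) := fun k => by
        rw [inner_smul_right, inner_smul_right, ← inner_conj_symm w, Complex.mul_conj']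
        push_cast
        rfl
      simp only [e] at h1
      exact Complex.hasSum_ofReal.1 h1
    have h3 := (hasSum_zero_iff_of_nonneg fun k => mul_nonneg (h.nonneg k) (sq_nonneg _)).1 h2
    have h4 := (mul_eq_zero.1 (congrFun h3 j)).resolve_left hj
    exact norm_eq_zero.1 (pow_eq_zero_iff two_ne_zero |>.1 h4)
  have hw : inner ℂ φ (ψ j - inner ℂ φ (ψ j) • φ) = 0 := by
    rw [inner_sub_right, inner_smul_right, hφφ, mul_one, sub_self]
  have h5 : ψ j = inner ℂ φ (ψ j) • φ := by
    rw [← sub_eq_zero, ← inner_self_eq_zero (𝕜 := ℂ)]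
    nth_rw 1 [inner_sub_left]
    rw [horth _ hw, inner_smul_left, hw, mul_zero, sub_zero]
  refine ⟨_, ?_, h5⟩
  have h6 := h.norm_eq_one j
  rwa [h5, norm_smul, hφ, mul_one] at h6

/-- A pure state decomposes only into copies of itself up to phases, to which the variance is blind.
All ensembles thus give the same average, and the minimum is over one value. -/
theorem isFisherInformation_rankOne (A : H →ₗ.[ℂ] H) {φ : H} (hφ : ‖φ‖ = 1) :
    IsFisherInformation A (InnerProductSpace.rankOne ℂ φ φ) (4 * variance A φ) := by
  have key : ∀ q ψ, IsEnsemble (InnerProductSpace.rankOne ℂ φ φ) q ψ →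
      averageFluctuation A q ψ = 4 * variance A φ := by
    intro q ψ h
    have e : ∀ j, ENNReal.ofReal (q j) * variance A (ψ j) =
        ENNReal.ofReal (q j) * variance A φ := by
      intro j
      by_cases hj : q j = 0
      · simp [hj]
      · obtain ⟨c, hc, hψ⟩ := h.exists_eq_smul hφ hj
        rw [hψ, variance_smul A hc]
    rw [averageFluctuation, tsum_congr e, ENNReal.tsum_mul_right,
      ← ENNReal.ofReal_tsum_of_nonneg h.nonneg h.hasSum_one.summable, h.hasSum_one.tsum_eq,
      ENNReal.ofReal_one, one_mul]
  refine ⟨⟨fun j => if j = 0 then 1 else 0, fun _ => φ, ?_⟩, ?_⟩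
  · have hens : IsEnsemble (InnerProductSpace.rankOne ℂ φ φ)
        (fun j => if j = 0 then 1 else 0) (fun _ => φ) := by
      refine ⟨fun j => by split_ifs <;> norm_num, hasSum_ite_eq 0 1, fun _ => hφ, ?_⟩
      convert hasSum_ite_eq 0 (InnerProductSpace.rankOne ℂ φ φ) using 2 with j
      split_ifs <;> simp
    exact ⟨hens, (key _ _ hens).symm⟩
  · rintro c ⟨q, ψ, h, rfl⟩
    exact (key q ψ h).ge

variable [CompleteSpace H]

theorem isDensityOperator_rankOne {φ : H} (hφ : ‖φ‖ = 1) :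
    IsDensityOperator (InnerProductSpace.rankOne ℂ φ φ) := by
  refine ⟨InnerProductSpace.isPositive_rankOne_self φ, ?_⟩
  have h := (someBasis H).hasSum_inner_mul_inner φ φ
  rw [inner_self_eq_norm_sq_to_K, hφ] at h
  simp only [InnerProductSpace.rankOne_apply, inner_smul_right]
  simpa using h

end Pure

end CoherenceCost

end

noncomputable section

namespace CoherenceCost

open scoped Matrix

/-! ### Operators `M ⊗ T` on the composite system -/

section Tensor

variable {n : Type*} [Fintype n] [DecidableEq n]
variable {H : Type*} [NormedAddCommGroup H] [InnerProductSpace ℂ H]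

theorem coord_tensorOp (M : Matrix n n ℂ) (T : H →L[ℂ] H) (ψ : Composite n H) (i : n) :
    coord i (tensorOp M T ψ) = ∑ j, M i j • T (coord j ψ) := by
  simp only [tensorOp, _root_.sum_apply, _root_.smul_apply,
    ContinuousLinearMap.comp_apply, map_sum, map_smul, coord_inj, smul_ite, smul_zero]
  rw [Finset.sum_comm]
  simp

theorem tensorOp_mul (M N : Matrix n n ℂ) (S T : H →L[ℂ] H) :
    tensorOp M S * tensorOp N T = tensorOp (M * N) (S * T) := by
  ext1 ψ
  refine composite_ext fun i => ?_
  simp only [mul_apply_eq_comp, coord_tensorOp, map_sum, map_smul, Matrix.mul_apply,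
    Finset.smul_sum, Finset.sum_smul, smul_smul]
  exact Finset.sum_comm

theorem tensorOp_one : tensorOp (1 : Matrix n n ℂ) (1 : H →L[ℂ] H) = 1 := by
  ext1 ψ
  refine composite_ext fun i => ?_
  simp [coord_tensorOp, Matrix.one_apply]

theorem tensorOp_sum {ι : Type*} (s : Finset ι) (M : ι → Matrix n n ℂ) (T : H →L[ℂ] H) :
    tensorOp (∑ k ∈ s, M k) T = ∑ k ∈ s, tensorOp (M k) T := by
  ext1 ψ
  refine composite_ext fun i => ?_
  simp only [coord_tensorOp, _root_.sum_apply, map_sum, Matrix.sum_apply,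
    Finset.sum_smul]
  exact Finset.sum_comm

theorem tensorOp_add (M N : Matrix n n ℂ) (T : H →L[ℂ] H) :
    tensorOp (M + N) T = tensorOp M T + tensorOp N T := by
  ext1 ψ
  refine composite_ext fun i => ?_
  simp [coord_tensorOp, add_smul, Finset.sum_add_distrib]

theorem tensorOp_smul (c : ℂ) (M : Matrix n n ℂ) (T : H →L[ℂ] H) :
    tensorOp (c • M) T = c • tensorOp M T := by
  ext1 ψ
  refine composite_ext fun i => ?_
  simp [coord_tensorOp, Finset.smul_sum, smul_smul]

theorem coord_comp_tensorOp_comp_inj (M : Matrix n n ℂ) (T : H →L[ℂ] H) (i j : n) :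
    coord i ∘L tensorOp M T ∘L inj j = M i j • T := by
  ext1 x
  simp only [ContinuousLinearMap.comp_apply, coord_tensorOp, coord_inj, _root_.smul_apply]
  rw [Finset.sum_eq_single j (fun k _ hk => by simp [hk]) (by simp)]
  simp

variable [CompleteSpace H]

theorem adjoint_tensorOp (M : Matrix n n ℂ) (T : H →L[ℂ] H) :
    ContinuousLinearMap.adjoint (tensorOp M T) = tensorOp Mᴴ (ContinuousLinearMap.adjoint T) := by
  symm
  rw [ContinuousLinearMap.eq_adjoint_iff]
  intro ψ φ
  simp only [inner_composite, coord_tensorOp, sum_inner, inner_sum, inner_smul_left,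
    inner_smul_right, ContinuousLinearMap.adjoint_inner_left, Matrix.conjTranspose_apply,
    RCLike.star_def, RCLike.conj_conj]
  exact Finset.sum_comm

/-- Parseval's identity, term by term. -/
theorem opTrace_sum_rankOne {ι : Type*} (s : Finset ι) (c : ι → ℂ) (x y : ι → H) :
    opTrace (∑ k ∈ s, c k • InnerProductSpace.rankOne ℂ (x k) (y k)) =
      ∑ k ∈ s, c k * inner ℂ (y k) (x k) := by
  have h := hasSum_sum fun k (_ : k ∈ s) =>
    ((someBasis H).hasSum_inner_mul_inner (y k) (x k)).mul_left (c k)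
  rw [← h.tsum_eq, opTrace]
  refine tsum_congr fun l => ?_
  simp only [_root_.sum_apply, _root_.smul_apply, InnerProductSpace.rankOne_apply,
    inner_sum, inner_smul_right]

/-- The environment factor of the `(α, β)` term is `|S_α φ⟩⟨S_β φ|`, of trace `⟨S_β φ, S_α φ⟩`. A
pure environment thus enters the channel through a Gram matrix alone. -/
theorem partialTrace_conj_rankOne {ι : Type*} [Fintype ι] (K : ι → Matrix n n ℂ)
    (S : ι → H →L[ℂ] H) (ρ : Matrix n n ℂ) (φ : H) :
    partialTrace ((∑ α, tensorOp (K α) (S α)) ∘L tensorOp ρ (InnerProductSpace.rankOne ℂ φ φ) ∘L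
      ContinuousLinearMap.adjoint (∑ α, tensorOp (K α) (S α))) =
    ∑ α, ∑ β, inner ℂ (S β φ) (S α φ) • (K α * ρ * (K β)ᴴ) := by
  have h : (∑ α, tensorOp (K α) (S α)) ∘L tensorOp ρ (InnerProductSpace.rankOne ℂ φ φ) ∘L
      ContinuousLinearMap.adjoint (∑ α, tensorOp (K α) (S α)) =
      ∑ p : ι × ι, tensorOp (K p.1 * ρ * (K p.2)ᴴ)
        (InnerProductSpace.rankOne ℂ (S p.1 φ) (S p.2 φ)) := by
    rw [Fintype.sum_prod_type, map_sum]
    change (∑ α, tensorOp (K α) (S α)) * (tensorOp ρ (InnerProductSpace.rankOne ℂ φ φ) *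
      ∑ β, ContinuousLinearMap.adjoint (tensorOp (K β) (S β))) = _
    rw [Finset.sum_mul]
    refine Finset.sum_congr rfl fun α _ => ?_
    rw [Finset.mul_sum, Finset.mul_sum]
    refine Finset.sum_congr rfl fun β _ => ?_
    rw [adjoint_tensorOp, tensorOp_mul, tensorOp_mul, Matrix.mul_assoc]
    congr 1
    ext1 x
    simp [mul_apply_eq_comp, InnerProductSpace.rankOne_apply,
      ContinuousLinearMap.adjoint_inner_right]
  rw [h]
  ext i j
  have h2 : (coord i : Composite n H →L[ℂ] H) ∘L (∑ p : ι × ι, tensorOp (K p.1 * ρ * (K p.2)ᴴ)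
        (InnerProductSpace.rankOne ℂ (S p.1 φ) (S p.2 φ))) ∘L inj j =
      ∑ p : ι × ι, (K p.1 * ρ * (K p.2)ᴴ) i j •
        InnerProductSpace.rankOne ℂ (S p.1 φ) (S p.2 φ) := by
    simp only [← coord_comp_tensorOp_comp_inj]
    ext1 x
    simp
  rw [partialTrace, Matrix.of_apply, h2, opTrace_sum_rankOne, Fintype.sum_prod_type]
  simp only [Matrix.sum_apply, Matrix.smul_apply, smul_eq_mul, mul_comm]

end Tensor

/-! ### Covariant extensions of operators on the system -/

section Covariant

variable {n : Type*} [Fintype n] [DecidableEq n]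
variable {H : Type*} [NormedAddCommGroup H] [InnerProductSpace ℂ H]

theorem CommutesWith.sum {ι : Type*} {T : H →ₗ.[ℂ] H} {B : ι → H →L[ℂ] H} (s : Finset ι)
    (h : ∀ k ∈ s, CommutesWith (B k) T) : CommutesWith (∑ k ∈ s, B k) T := by
  classical
  induction s using Finset.induction_on with
  | empty =>
    intro x
    exact ⟨T.domain.zero_mem, T.map_zero⟩
  | insert k s hk ih =>
    intro x
    obtain ⟨h1, e1⟩ := h k (Finset.mem_insert_self k s) x
    obtain ⟨h2, e2⟩ := ih (fun l hl => h l (Finset.mem_insert_of_mem hl)) x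
    rw [Finset.sum_insert hk]
    refine ⟨T.domain.add_mem h1 h2, (T.map_add ⟨_, h1⟩ ⟨_, h2⟩).trans ?_⟩
    rw [_root_.add_apply, e1, e2]

variable [CompleteSpace H]

/-- `T` is a unitary representation of `ℝ` that shifts the operator `A`: `A T_s = T_s (A + s)`. -/
structure IsShiftGroup (A : H →ₗ.[ℂ] H) (T : ℝ → H →L[ℂ] H) : Prop where
  zero : T 0 = 1
  add : ∀ s t, T (s + t) = T s * T t
  adjoint : ∀ s, ContinuousLinearMap.adjoint (T s) = T (-s)
  shift : ∀ s (f : A.domain), ∃ h : T s f ∈ A.domain,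
    A ⟨T s f, h⟩ = T s (A f) + (s : ℂ) • T s f

/-- `A = ∑ a_k P_k` with pairwise orthogonal projections `P_k` of sum `1`. -/
structure IsSpectralFamily (A : Matrix n n ℂ) (a : n → ℝ) (P : n → Matrix n n ℂ) : Prop where
  orthogonal : ∀ k l, P k * P l = if k = l then P k else 0
  isHermitian : ∀ k, (P k)ᴴ = P k
  sum_eq_one : ∑ k, P k = 1
  eq_sum : A = ∑ k, (a k : ℂ) • P k

namespace IsSpectralFamily

variable {A : Matrix n n ℂ} {a : n → ℝ} {P : n → Matrix n n ℂ}

theorem mul_proj (h : IsSpectralFamily A a P) (k : n) : A * P k = (a k : ℂ) • P k := by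
  rw [h.eq_sum, Finset.sum_mul]
  simp [h.orthogonal]

theorem proj_mul (h : IsSpectralFamily A a P) (k : n) : P k * A = (a k : ℂ) • P k := by
  rw [h.eq_sum, Finset.mul_sum]
  simp [h.orthogonal]

end IsSpectralFamily

/-- By `hM`, `M` lowers the system charge by `s`, while `T s` raises the environment charge by `s`.
-/
theorem commutesWith_tensorOp {AS M : Matrix n n ℂ} {AE : H →ₗ.[ℂ] H} {T : ℝ → H →L[ℂ] H}
    (hT : IsShiftGroup AE T) {s : ℝ} (hM : AS * M + (s : ℂ) • M = M * AS) :
    CommutesWith (tensorOp M (T s)) (totalCharge AS AE) := by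
  intro ψ
  have hmem : ∀ i j, M i j • T s (coord j (ψ : Composite n H)) ∈ AE.domain := fun i j =>
    AE.domain.smul_mem _ (hT.shift s ⟨_, ψ.2 j⟩).choose
  have hdom : ∀ i, coord i (tensorOp M (T s) ψ) ∈ AE.domain := fun i => by
    rw [coord_tensorOp]
    exact AE.domain.sum_mem fun j _ => hmem i j
  refine ⟨hdom, composite_ext fun i => ?_⟩
  rw [coord_totalCharge]
  have e1 : AE ⟨coord i (tensorOp M (T s) ψ), hdom i⟩ =
      ∑ j, M i j • (T s (AE ⟨coord j (ψ : Composite n H), ψ.2 j⟩) +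
        (s : ℂ) • T s (coord j (ψ : Composite n H))) := by
    have : (⟨coord i (tensorOp M (T s) ψ), hdom i⟩ : AE.domain) =
        ∑ j, M i j • ⟨T s (coord j (ψ : Composite n H)), (hT.shift s ⟨_, ψ.2 j⟩).choose⟩ := by
      refine Subtype.ext ?_
      simp only [coord_tensorOp, Submodule.coe_sum, Submodule.coe_smul]
    rw [this, ← LinearPMap.toFun_eq_coe, map_sum]
    refine Finset.sum_congr rfl fun j _ => ?_
    rw [map_smul]
    congr 1
    exact (hT.shift s ⟨_, ψ.2 j⟩).choose_spec
  refine (congrArg _ e1).trans ?_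
  simp only [coord_tensorOp, coord_totalCharge, map_add, map_sum, map_smul, smul_add,
    Finset.sum_add_distrib, Finset.smul_sum, smul_smul]
  rw [add_comm (∑ j, M i j • T s (AE _)), ← add_assoc]
  congr 1
  rw [Finset.sum_comm, ← Finset.sum_add_distrib, Finset.sum_comm (γ := n)]
  refine Finset.sum_congr rfl fun k _ => ?_
  have := congrFun (congrFun hM i) k
  simp only [Matrix.add_apply, Matrix.mul_apply, Matrix.smul_apply, smul_eq_mul] at this
  rw [← Finset.sum_smul, ← Finset.sum_smul, ← add_smul, ← this, mul_comm (M i k)]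

variable (a : n → ℝ) (P : n → Matrix n n ℂ) (T : ℝ → H →L[ℂ] H)

/-- The operator `∑_k P_k ⊗ T_{a_k}`. -/
def controlledShift : Composite n H →L[ℂ] Composite n H := ∑ k, tensorOp (P k) (T (a k))

/-- The operator `W† (M ⊗ 1) W` with `W` the controlled shift. -/
def covariantExtension (M : Matrix n n ℂ) : Composite n H →L[ℂ] Composite n H :=
  ContinuousLinearMap.adjoint (controlledShift a P T) * tensorOp M 1 * controlledShift a P T

variable {a P T} {AS : Matrix n n ℂ} {AE : H →ₗ.[ℂ] H}

theorem adjoint_controlledShift (hP : IsSpectralFamily AS a P) (hT : IsShiftGroup AE T) :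
    ContinuousLinearMap.adjoint (controlledShift a P T) = ∑ k, tensorOp (P k) (T (-a k)) := by
  rw [controlledShift, map_sum]
  refine Finset.sum_congr rfl fun k _ => ?_
  rw [adjoint_tensorOp, hP.isHermitian, hT.adjoint]

theorem covariantExtension_eq_sum (hP : IsSpectralFamily AS a P) (hT : IsShiftGroup AE T)
    (M : Matrix n n ℂ) : covariantExtension a P T M =
      ∑ p : n × n, tensorOp (P p.1 * M * P p.2) (T (a p.2 - a p.1)) := by
  rw [covariantExtension, adjoint_controlledShift hP hT, controlledShift, Fintype.sum_prod_type,
    Finset.sum_mul, Finset.sum_mul]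
  refine Finset.sum_congr rfl fun k _ => ?_
  rw [Finset.mul_sum]
  refine Finset.sum_congr rfl fun l _ => ?_
  rw [tensorOp_mul, tensorOp_mul, mul_one, ← hT.add, neg_add_eq_sub]

theorem controlledShift_mul_adjoint (hP : IsSpectralFamily AS a P) (hT : IsShiftGroup AE T) :
    controlledShift a P T * ContinuousLinearMap.adjoint (controlledShift a P T) = 1 := by
  rw [adjoint_controlledShift hP hT, controlledShift, Finset.sum_mul_sum]
  simp only [tensorOp_mul, ← hT.add, hP.orthogonal]
  rw [← tensorOp_one, ← hP.sum_eq_one, tensorOp_sum]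
  refine Finset.sum_congr rfl fun k _ => ?_
  rw [Finset.sum_eq_single k _ (by simp)]
  · rw [if_pos rfl, add_neg_cancel, hT.zero]
  · intro l _ hl
    rw [if_neg (Ne.symm hl)]
    -- The off-diagonal terms vanish because `0 ⊗ T = 0`, read off from homogeneity with scalar `0`.
    simpa using tensorOp_smul (0 : ℂ) (0 : Matrix n n ℂ) (T (a k + -a l))

theorem adjoint_mul_controlledShift (hP : IsSpectralFamily AS a P) (hT : IsShiftGroup AE T) :
    ContinuousLinearMap.adjoint (controlledShift a P T) * controlledShift a P T = 1 := by
  rw [adjoint_controlledShift hP hT, controlledShift, Finset.sum_mul_sum]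
  simp only [tensorOp_mul, ← hT.add, hP.orthogonal]
  rw [← tensorOp_one, ← hP.sum_eq_one, tensorOp_sum]
  refine Finset.sum_congr rfl fun k _ => ?_
  rw [Finset.sum_eq_single k _ (by simp)]
  · rw [if_pos rfl, neg_add_cancel, hT.zero]
  · intro l _ hl
    rw [if_neg (Ne.symm hl)]
    simpa using tensorOp_smul (0 : ℂ) (0 : Matrix n n ℂ) (T (-a k + a l))

theorem covariantExtension_add (M N : Matrix n n ℂ) : covariantExtension a P T (M + N) =
    covariantExtension a P T M + covariantExtension a P T N := by
  simp only [covariantExtension, tensorOp_add, mul_add, add_mul]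

theorem covariantExtension_smul (c : ℂ) (M : Matrix n n ℂ) :
    covariantExtension a P T (c • M) = c • covariantExtension a P T M := by
  simp only [covariantExtension, tensorOp_smul, mul_smul_comm, smul_mul_assoc]

theorem covariantExtension_one (hP : IsSpectralFamily AS a P) (hT : IsShiftGroup AE T) :
    covariantExtension a P T 1 = 1 := by
  rw [covariantExtension, tensorOp_one, mul_one, adjoint_mul_controlledShift hP hT]

theorem covariantExtension_mul (hP : IsSpectralFamily AS a P) (hT : IsShiftGroup AE T)
    (M N : Matrix n n ℂ) : covariantExtension a P T (M * N) =
      covariantExtension a P T M * covariantExtension a P T N := by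
  simp only [covariantExtension]
  rw [← mul_one (1 : H →L[ℂ] H), ← tensorOp_mul, mul_one]
  simp only [mul_assoc]
  rw [← mul_assoc (controlledShift a P T) (ContinuousLinearMap.adjoint _),
    controlledShift_mul_adjoint hP hT, one_mul]

/-- The covariant extension as a homomorphism of algebras. -/
def covariantExtensionHom (hP : IsSpectralFamily AS a P) (hT : IsShiftGroup AE T) :
    Matrix n n ℂ →ₐ[ℂ] (Composite n H →L[ℂ] Composite n H) :=
  AlgHom.ofLinearMap
    { toFun := covariantExtension a P T
      map_add' := covariantExtension_add
      map_smul' := covariantExtension_smul }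
    (covariantExtension_one hP hT) (covariantExtension_mul hP hT)

theorem covariantExtensionHom_apply (hP : IsSpectralFamily AS a P) (hT : IsShiftGroup AE T)
    (M : Matrix n n ℂ) : covariantExtensionHom hP hT M = covariantExtension a P T M := rfl

theorem isSelfAdjoint_covariantExtension {M : Matrix n n ℂ} (hM : M.IsHermitian) :
    IsSelfAdjoint (covariantExtension a P T M) := by
  rw [IsSelfAdjoint, covariantExtension, star_mul, star_mul]
  simp only [ContinuousLinearMap.star_eq_adjoint, ContinuousLinearMap.adjoint_adjoint,
    adjoint_tensorOp, hM.eq, ← mul_assoc]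
  rw [← ContinuousLinearMap.star_eq_adjoint (1 : H →L[ℂ] H), star_one]

/-- Each block `P_k M P_l` changes the system charge from `a_l` to `a_k`, and its translation by
`a_l - a_k` compensates for this. -/
theorem commutesWith_covariantExtension (hP : IsSpectralFamily AS a P) (hT : IsShiftGroup AE T)
    (M : Matrix n n ℂ) : CommutesWith (covariantExtension a P T M) (totalCharge AS AE) := by
  rw [covariantExtension_eq_sum hP hT]
  refine CommutesWith.sum _ fun p _ => commutesWith_tensorOp hT ?_
  rw [← mul_assoc, ← mul_assoc, hP.mul_proj, mul_assoc _ _ AS, hP.proj_mul, smul_mul_assoc,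
    smul_mul_assoc, mul_smul_comm, ← add_smul]
  congr 1
  push_cast
  ring

end Covariant

end CoherenceCost

end

noncomputable section

namespace CoherenceCost

open scoped Matrix ComplexOrder

/-! ### Estimates in C⋆-algebras -/

section CStar

variable {𝔄 : Type*} [CStarAlgebra 𝔄]

theorem exp_real_smul_mem_unitary {a : 𝔄} (ha : IsSelfAdjoint a) (p : ℝ) :
    NormedSpace.exp (p • (Complex.I • a)) ∈ unitary 𝔄 := by
  have h : IsSelfAdjoint (p • a) := (IsSelfAdjoint.all p).smul ha
  have := (selfAdjoint.expUnitary ⟨p • a, h⟩).2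
  rwa [selfAdjoint.expUnitary_coe, smul_comm] at this

/-- The derivative of `e^{-itb} e^{ita}` is `e^{-itb} i(a - b) e^{ita}`, whose norm is `‖b - a‖`
because the outer factors are unitary. The mean value inequality concludes. -/
theorem norm_exp_mul_exp_sub_one_le {a b : 𝔄} (ha : IsSelfAdjoint a) (hb : IsSelfAdjoint b)
    (p : ℝ) :
    ‖NormedSpace.exp (p • (-(Complex.I • b))) * NormedSpace.exp (p • (Complex.I • a)) - 1‖ ≤
      ‖b - a‖ * |p| := by
  have hderiv : ∀ t : ℝ, HasDerivAt (fun t : ℝ => NormedSpace.exp (t • (-(Complex.I • b))) *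
      NormedSpace.exp (t • (Complex.I • a)))
      (NormedSpace.exp (t • (-(Complex.I • b))) * (Complex.I • (a - b)) *
        NormedSpace.exp (t • (Complex.I • a))) t := by
    intro t
    refine HasDerivAt.congr_deriv ((hasDerivAt_exp_smul_const (𝕂 := ℝ) (-(Complex.I • b)) t).mul
      (hasDerivAt_exp_smul_const' (𝕂 := ℝ) (Complex.I • a) t)) ?_
    rw [smul_sub]
    noncomm_ring
  have hnorm : ∀ t : ℝ, ‖NormedSpace.exp (t • (-(Complex.I • b))) * (Complex.I • (a - b)) *
        NormedSpace.exp (t • (Complex.I • a))‖ ≤ ‖b - a‖ := by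
    intro t
    have hb' := exp_real_smul_mem_unitary hb.neg t
    rw [smul_neg] at hb'
    rw [CStarRing.norm_mul_mem_unitary _ (exp_real_smul_mem_unitary ha t),
      CStarRing.norm_mem_unitary_mul _ hb', norm_smul, Complex.norm_I, one_mul, norm_sub_rev]
  have := Convex.norm_image_sub_le_of_norm_hasDerivWithin_le (x := 0) (y := p)
    (fun t _ => (hderiv t).hasDerivWithinAt) (fun t _ => hnorm t) convex_univ
    (Set.mem_univ _) (Set.mem_univ _)
  simpa using this

theorem exists_isSelfAdjoint_exp_eq {u : 𝔄} (hu : u ∈ unitary 𝔄) (hfin : (spectrum ℂ u).Finite) :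
    ∃ a : 𝔄, IsSelfAdjoint a ∧ NormedSpace.exp (Complex.I • a) = u := by
  -- On a finite spectrum the branch cut of `arg` is harmless, so the functional calculus supplies a
  -- logarithm of every such unitary.
  have : ContinuousOn Complex.arg (spectrum ℂ u) := hfin.continuousOn _
  have hn : IsStarNormal u :=
    ⟨(Unitary.star_mul_self_of_mem hu).trans (Unitary.mul_star_self_of_mem hu).symm⟩
  refine ⟨cfc (fun z => (Complex.arg z : ℂ)) u, IsSelfAdjoint.cfc_arg u, ?_⟩
  rw [← cfc_smul _ _ _ (by fun_prop), ← CFC.exp_eq_normedSpace_exp (𝕜 := ℂ),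
    ← cfc_comp' NormedSpace.exp _ u (NormedSpace.exp_continuous.continuousOn) (by fun_prop)]
  conv_rhs => rw [← cfc_id' ℂ u]
  refine cfc_congr fun y hy => ?_
  have hy₁ : ‖y‖ = 1 := spectrum.norm_eq_one_of_unitary hu hy
  have hy₀ : y ≠ 0 := by
    rintro rfl
    simp at hy₁
  have : Complex.I * y.arg = Complex.log y :=
    Complex.ext (by simp [Complex.log_re, hy₁]) (by simp [Complex.log_im])
  simp only [smul_eq_mul, this, ← Complex.exp_eq_exp_ℂ, Complex.exp_log hy₀]

end CStar

/-! ### Estimates for matrices -/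

section Matrices

variable {n : Type*} [Fintype n] [DecidableEq n]

open scoped Matrix.Norms.L2Operator MatrixOrder

theorem norm_sub_midpoint_le_asymmetry {A U : Matrix n n ℂ} (hA : A.IsHermitian) :
    ∃ c : ℝ, ‖(U.conjTranspose * A * U - A) - (c : ℂ) • (1 : Matrix n n ℂ)‖ ≤ asymmetry A U := by
  set X := U.conjTranspose * A * U - A with hX
  have hXh : X.IsHermitian := (Matrix.isHermitian_conjTranspose_mul_mul U hA).sub hA
  have hXs : IsSelfAdjoint X := hXh
  have hfin : (spectrum ℝ X).Finite := by
    rw [hXh.spectrum_real_eq_range_eigenvalues]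
    exact Set.finite_range _
  -- Subtracting the midpoint of the spectrum centres it at zero and turns half its width into a
  -- norm bound.
  refine ⟨(lambdaMax X + lambdaMin X) / 2, ?_⟩
  have hle : lambdaMin X ≤ lambdaMax X := Real.sInf_le_sSup _ hfin.bddBelow hfin.bddAbove
  have hasym : asymmetry A U = (lambdaMax X - lambdaMin X) / 2 := rfl
  rw [hasym]
  have e : X - (((lambdaMax X + lambdaMin X) / 2 : ℝ) : ℂ) • (1 : Matrix n n ℂ) =
      cfc (fun x : ℝ => x - (lambdaMax X + lambdaMin X) / 2) X := by
    rw [cfc_sub _ _ _, cfc_id' ℝ X, cfc_const _ X, Algebra.algebraMap_eq_smul_one]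
    rfl
  rw [e]
  refine norm_cfc_le (by linarith) fun x hx => ?_
  have h1 : x ≤ lambdaMax X := le_csSup hfin.bddAbove hx
  have h2 : lambdaMin X ≤ x := csInf_le hfin.bddBelow hx
  rw [Real.norm_eq_abs, abs_le]
  constructor <;> linarith

/-- For unitary `W`, `(W - 1)†(W - 1) = 2 - W - W†`, whose expectation in `ρ` is `2 - 2 Re tr(ρ W)`
and is at most `‖W - 1‖²`. -/
theorem one_sub_le_re_trace_mul (ρ : DensityMatrix n) {W : Matrix n n ℂ}
    (hW : W ∈ Matrix.unitaryGroup n ℂ) :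
    1 - ‖W - 1‖ ^ 2 / 2 ≤ (ρ.mat * W).trace.re := by
  have h1 : star (W - 1) * (W - 1) ≤ algebraMap ℝ _ (‖W - 1‖ ^ 2) :=
    CStarAlgebra.star_mul_le_algebraMap_norm_sq
  rw [Matrix.le_iff] at h1
  obtain ⟨R, hR⟩ := CStarAlgebra.nonneg_iff_eq_star_mul_self.1
    (Matrix.nonneg_iff_posSemidef.2 ρ.posSemidef)
  have h2 := (h1.mul_mul_conjTranspose_same R).trace_nonneg
  rw [Matrix.trace_mul_comm, ← mul_assoc, ← Matrix.star_eq_conjTranspose, ← hR] at h2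
  have h3 : star (W - 1) * (W - 1) = 1 + 1 - W - star W := by
    have := (Matrix.mem_unitaryGroup_iff'.1 hW)
    rw [star_sub, star_one, sub_mul, mul_sub, this, mul_one, one_mul]
    abel
  have h4 : (ρ.mat * star W).trace = star (ρ.mat * W).trace := by
    rw [← Matrix.trace_conjTranspose, Matrix.conjTranspose_mul, ρ.posSemidef.isHermitian.eq,
      Matrix.trace_mul_comm]
    rfl
  rw [h3, Algebra.algebraMap_eq_smul_one] at h2
  have h5 : (ρ.mat * ((‖W - 1‖ ^ 2) • (1 : Matrix n n ℂ) - (1 + 1 - W - star W))).trace =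
      ((‖W - 1‖ ^ 2 : ℝ) : ℂ) - 2 + (ρ.mat * W).trace + star (ρ.mat * W).trace := by
    rw [← h4]
    simp only [mul_sub, mul_add, mul_one, Matrix.mul_smul, Matrix.trace_sub, Matrix.trace_add,
      Matrix.trace_smul, ρ.trace_eq_one, Complex.real_smul]
    push_cast
    ring
  rw [h5] at h2
  have h6 := (Complex.le_def.1 h2).1
  simp only [Complex.zero_re, Complex.add_re, Complex.sub_re, Complex.ofReal_re,
    Complex.star_def, Complex.conj_re, Complex.re_ofNat] at h6
  linarith

namespace IsSpectralFamily

variable {A B : Matrix n n ℂ} {a b : n → ℝ} {P Q : n → Matrix n n ℂ}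

theorem isHermitian_self (h : IsSpectralFamily A a P) : A.IsHermitian := by
  rw [Matrix.IsHermitian, h.eq_sum, Matrix.conjTranspose_sum]
  simp [Matrix.conjTranspose_smul, h.isHermitian]

/-- `x ↦ ∑ x_k P_k` is a continuous algebra homomorphism from `ℂⁿ`, so it commutes with the
exponential. -/
theorem exp_smul (h : IsSpectralFamily A a P) (c : ℂ) :
    NormedSpace.exp (c • A) = ∑ k, Complex.exp (c * a k) • P k := by
  let f : (n → ℂ) →ₐ[ℂ] Matrix n n ℂ := AlgHom.ofLinearMap
    (∑ k, (LinearMap.proj k : (n → ℂ) →ₗ[ℂ] ℂ).smulRight (P k))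
    (by simp [h.sum_eq_one])
    (by
      intro x y
      simp only [LinearMap.sum_apply, LinearMap.smulRight_apply, LinearMap.proj_apply,
        Pi.mul_apply, Finset.sum_mul_sum, smul_mul_smul_comm, h.orthogonal]
      simp)
  have hf : ∀ x, f x = ∑ k, x k • P k := fun x => by
    simp [f]
  have hc : Continuous f := f.toLinearMap.continuous_of_finiteDimensional
  have e : c • A = f fun k => c * a k := by
    rw [hf, h.eq_sum, Finset.smul_sum]
    simp only [smul_smul]
  rw [e, ← NormedSpace.map_exp f hc, hf]
  simp only [Pi.coe_exp, Complex.exp_eq_exp_ℂ]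

theorem conj (h : IsSpectralFamily A a P) {U : Matrix n n ℂ} (hU : U ∈ Matrix.unitaryGroup n ℂ) :
    IsSpectralFamily (Uᴴ * A * U) a fun k => Uᴴ * P k * U where
  orthogonal k l := by
    have hU' : U * Uᴴ = 1 := Matrix.mem_unitaryGroup_iff.1 hU
    have : Uᴴ * P k * U * (Uᴴ * P l * U) = Uᴴ * (P k * (U * Uᴴ) * P l) * U := by
      simp only [mul_assoc]
    rw [this, hU', mul_one, h.orthogonal]
    split_ifs <;> simp
  isHermitian k := Matrix.isHermitian_conjTranspose_mul_mul U (h.isHermitian k)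
  sum_eq_one := by
    rw [← Finset.sum_mul, ← Finset.mul_sum, h.sum_eq_one, mul_one]
    exact Matrix.mem_unitaryGroup_iff'.1 hU
  eq_sum := by
    rw [h.eq_sum, Finset.mul_sum, Finset.sum_mul]
    simp

theorem sub_smul_one (h : IsSpectralFamily A a P) (c : ℝ) :
    IsSpectralFamily (A - (c : ℂ) • (1 : Matrix n n ℂ)) (fun k => a k - c) P where
  orthogonal := h.orthogonal
  isHermitian := h.isHermitian
  sum_eq_one := h.sum_eq_one
  eq_sum := by
    conv_lhs => rw [h.eq_sum, ← h.sum_eq_one, Finset.smul_sum, ← Finset.sum_sub_distrib]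
    simp [sub_smul]

/-- The double sum is `tr(ρ e^{-ipB} e^{ipA})` expanded in spectral projections, and `e^{-ipB}
e^{ipA}` is a unitary within `‖B - A‖ |p|` of `1`. -/
theorem one_sub_le_re_sum (hA : IsSpectralFamily A a P) (hB : IsSpectralFamily B b Q)
    (ρ : DensityMatrix n) (p : ℝ) :
    1 - ‖B - A‖ ^ 2 / 2 * p ^ 2 ≤ (∑ k, ∑ l,
      (ρ.mat * (Q k * P l)).trace * Complex.exp (p * (a l - b k : ℝ) * Complex.I)).re := by
  set W := NormedSpace.exp (p • (-(Complex.I • B))) * NormedSpace.exp (p • (Complex.I • A))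
    with hW
  have hA' : IsSelfAdjoint A := hA.isHermitian_self
  have hB' : IsSelfAdjoint B := hB.isHermitian_self
  have hWu : W ∈ Matrix.unitaryGroup n ℂ := by
    have h := exp_real_smul_mem_unitary hB'.neg p
    rw [smul_neg] at h
    exact mul_mem h (exp_real_smul_mem_unitary hA' p)
  have hWn : ‖W - 1‖ ^ 2 ≤ ‖B - A‖ ^ 2 * p ^ 2 := by
    rw [← sq_abs p, ← mul_pow]
    exact pow_le_pow_left₀ (norm_nonneg _) (norm_exp_mul_exp_sub_one_le hA' hB' p) 2
  have hWs : W = ∑ k, ∑ l, Complex.exp (p * (a l - b k : ℝ) * Complex.I) • (Q k * P l) := by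
    have e1 : p • (-(Complex.I • B)) = (-(p * Complex.I)) • B := by
      rw [← Complex.coe_smul, smul_neg, smul_smul, neg_smul]
    have e2 : p • (Complex.I • A) = (p * Complex.I) • A := by
      rw [← Complex.coe_smul, smul_smul]
    rw [hW, e1, e2, hA.exp_smul, hB.exp_smul, Finset.sum_mul_sum]
    refine Finset.sum_congr rfl fun k _ => Finset.sum_congr rfl fun l _ => ?_
    rw [smul_mul_smul_comm, ← Complex.exp_add]
    congr 2
    push_cast
    ring
  have h := one_sub_le_re_trace_mul ρ hWu
  rw [hWs] at h
  simp only [Finset.mul_sum, Matrix.trace_sum, Matrix.mul_smul, Matrix.trace_smul,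
    smul_eq_mul] at h
  rw [← hWs] at h
  simp only [mul_comm (Complex.exp _)] at h
  linarith

end IsSpectralFamily

/-- The projections are those on the vectors of an eigenbasis; indexing by `n` lets eigenvalues
repeat. -/
theorem exists_isSpectralFamily {A : Matrix n n ℂ} (hA : A.IsHermitian) :
    ∃ a P, IsSpectralFamily A a P := by
  set V : Matrix n n ℂ := hA.eigenvectorUnitary.1 with hV
  have hV1 : star V * V = 1 := Unitary.coe_star_mul_self hA.eigenvectorUnitary
  have hdiag : IsSpectralFamily (Matrix.diagonal fun k => (hA.eigenvalues k : ℂ)) hA.eigenvalues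
      fun k => Matrix.diagonal (Pi.single k 1) := by
    refine ⟨fun k l => ?_, fun k => ?_, ?_, ?_⟩
    · rw [Matrix.diagonal_mul_diagonal]
      split_ifs with h
      · subst h
        congr 1
        ext i
        by_cases hi : i = k <;> simp [hi]
      · ext i j
        by_cases hi : i = k <;> simp [hi, Matrix.diagonal_apply, h]
    · rw [Matrix.diagonal_conjTranspose, ← Pi.single_star, star_one]
    · ext i j
      by_cases h : i = j
      · subst h
        simp [Matrix.sum_apply, Pi.single_apply]
      · simp [Matrix.sum_apply, h]
    · ext i j
      by_cases h : i = j
      · subst h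
        simp [Matrix.sum_apply, Pi.single_apply]
      · simp [Matrix.sum_apply, h]
  have hV' : star V ∈ Matrix.unitaryGroup n ℂ :=
    Matrix.mem_unitaryGroup_iff.2 (by rw [star_star, hV1])
  have e : A = (star V)ᴴ * Matrix.diagonal (fun k => (hA.eigenvalues k : ℂ)) * star V := by
    conv_lhs => rw [hA.spectral_theorem, Unitary.conjStarAlgAut_apply]
    rw [← Matrix.star_eq_conjTranspose, star_star]
    rfl
  have h := hdiag.conj hV'
  rw [← e] at h
  exact ⟨_, _, h⟩

end Matrices

/-! ### Gaussian averages -/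

section Average

open MeasureTheory ProbabilityTheory
open scoped NNReal

/-- Average the hypothesis over `p` with law `N(0, v)`: the mean of `p²` is `v`, and that of
`e^{ipx}` is `e^{-v x²/2}`. -/
theorem one_sub_le_re_sum_mul_exp {ι : Type*} (s : Finset ι) (w : ι → ℂ) (x : ι → ℝ) (C : ℝ)
    (v : ℝ≥0)
    (h : ∀ p : ℝ, 1 - C * p ^ 2 ≤ (∑ α ∈ s, w α * Complex.exp (p * x α * Complex.I)).re) :
    1 - C * v ≤ (∑ α ∈ s, w α * Complex.exp (-(v * x α ^ 2 / 2))).re := by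
  have hint : ∀ t : ℝ, Integrable (fun p : ℝ => Complex.exp (p * t * Complex.I))
      (gaussianReal 0 v) := by
    intro t
    refine (integrable_const (1 : ℝ)).mono' (by fun_prop)
      (Filter.Eventually.of_forall fun p => ?_)
    rw [← Complex.ofReal_mul, Complex.norm_exp_ofReal_mul_I]
  have hint' : Integrable (fun p : ℝ => ∑ α ∈ s, w α * Complex.exp (p * x α * Complex.I))
      (gaussianReal 0 v) := integrable_finsetSum _ fun α _ => (hint (x α)).const_mul _
  have hsq : Integrable (fun p : ℝ => p ^ 2) (gaussianReal 0 v) :=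
    (memLp_id_gaussianReal (μ := 0) (v := v) 2).integrable_sq
  have hvar : ∫ p : ℝ, p ^ 2 ∂gaussianReal 0 v = v := by
    have h := variance_id_gaussianReal (μ := 0) (v := v)
    rw [variance_eq_integral aemeasurable_id] at h
    simpa only [id, integral_id_gaussianReal, sub_zero] using h
  have h1 : ∫ p : ℝ, (1 - C * p ^ 2) ∂gaussianReal 0 v = 1 - C * v := by
    rw [integral_sub (integrable_const _) (hsq.const_mul C), integral_const_mul, hvar]
    simp
  have h2 : ∫ p : ℝ, (∑ α ∈ s, w α * Complex.exp (p * x α * Complex.I)) ∂gaussianReal 0 v =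
      ∑ α ∈ s, w α * Complex.exp (-(v * x α ^ 2 / 2)) := by
    rw [integral_finsetSum _ fun α _ => (hint (x α)).const_mul _]
    refine Finset.sum_congr rfl fun α _ => ?_
    rw [integral_const_mul]
    have := charFun_gaussianReal (μ := 0) (v := v) (x α)
    rw [charFun_apply_real] at this
    congr 1
    simp only [mul_comm (x α : ℂ)] at this
    rw [this]
    congr 1
    simp
  rw [← h1, ← h2]
  have h3 := integral_re hint'
  refine (integral_mono ((integrable_const _).sub (hsq.const_mul C)) hint'.re h).trans h3.le

end Average

end CoherenceCost

end

noncomputable section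

namespace CoherenceCost

open scoped Matrix ComplexOrder

/-! ### Entanglement fidelity of channels with a pure environment -/

section GramChannel

variable {n ι : Type*} [Fintype n] [DecidableEq n] [Fintype ι]
variable {H : Type*} [NormedAddCommGroup H] [InnerProductSpace ℂ H]

/-- The map `X ↦ ∑_{α,β} ⟨y_β, y_α⟩ L_α X L_β†`. -/
def gramChannel (y : ι → H) (L : ι → Matrix n n ℂ) : Matrix n n ℂ →ₗ[ℂ] Matrix n n ℂ where
  toFun X := ∑ α, ∑ β, inner ℂ (y β) (y α) • (L α * X * (L β)ᴴ)
  map_add' X Y := by simp only [mul_add, add_mul, smul_add, Finset.sum_add_distrib]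
  map_smul' c X := by
    simp only [Matrix.mul_smul, Matrix.smul_mul, Finset.smul_sum, RingHom.id_apply, smul_comm c]

theorem gramChannel_apply (y : ι → H) (L : ι → Matrix n n ℂ) (X : Matrix n n ℂ) :
    gramChannel y L X = ∑ α, ∑ β, inner ℂ (y β) (y α) • (L α * X * (L β)ᴴ) := rfl

/-- For a purification `ψ` of `ρ`, `⟨ψ| L_α ⊗ 1 |ψ⟩ = tr(ρ L_α)`. The squared fidelity is therefore
the Gram form of the `y_α` with these coefficients. -/
theorem entanglementFidelity_gramChannel (y : ι → H) (L : ι → Matrix n n ℂ)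
    (ρ : DensityMatrix n) :
    entanglementFidelity ρ (gramChannel y L) = ‖∑ α, (ρ.mat * L α).trace • y α‖ := by
  rw [entanglementFidelity, pureFidelity_eq _ (purification_isPurification ρ),
    ← Real.sqrt_sq (norm_nonneg (∑ α, (ρ.mat * L α).trace • y α)),
    norm_sq_eq_re_inner (𝕜 := ℂ)]
  congr 1
  refine congrArg Complex.re ?_
  have hconj : ∀ β, (starRingEnd ℂ) (ρ.mat * L β).trace = ((L β)ᴴ * ρ.mat).trace := by
    intro β
    rw [starRingEnd_apply, ← Matrix.trace_conjTranspose, Matrix.conjTranspose_mul,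
      ρ.posSemidef.isHermitian.eq]
  have hsingle : ∀ (M N : Matrix n n ℂ) (a b i j : n),
      (M * Matrix.single a b (1 : ℂ) * N : Matrix n n ℂ) i j = M i a * N b j := by
    intro M N a b i j
    rw [Matrix.mul_apply, Finset.sum_eq_single b]
    · simp
    · intro c _ hc
      simp [hc]
    · simp
  have hterm : ∀ α β, ∑ i, ∑ j, ∑ a, ∑ b, ρ.mat a i * ρ.mat j b * (L α i a * (L β)ᴴ b j) =
      (ρ.mat * L α).trace * ((L β)ᴴ * ρ.mat).trace := by
    intro α β
    rw [Matrix.trace_mul_comm ρ.mat (L α), Matrix.trace_mul_comm (L β)ᴴ ρ.mat, Matrix.trace, Matrix.trace,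
      Finset.sum_mul_sum]
    refine Finset.sum_congr rfl fun i _ => Finset.sum_congr rfl fun j _ => ?_
    rw [Matrix.diag_apply, Matrix.diag_apply, Matrix.mul_apply, Matrix.mul_apply,
      Finset.sum_mul_sum]
    refine Finset.sum_congr rfl fun a _ => Finset.sum_congr rfl fun b _ => ?_
    ring
  simp only [inner_sum, sum_inner, inner_smul_left, inner_smul_right, hconj, gramChannel_apply,
    Matrix.sum_apply, Matrix.smul_apply, hsingle, smul_eq_mul, Finset.mul_sum]
  simp only [Finset.sum_comm (s := (Finset.univ : Finset n)) (t := (Finset.univ : Finset ι))]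
  refine Finset.sum_congr rfl fun α _ => Finset.sum_congr rfl fun β _ => ?_
  rw [← mul_assoc, ← hterm]
  simp only [Finset.sum_mul]
  refine Finset.sum_congr rfl fun i _ => Finset.sum_congr rfl fun j _ =>
    Finset.sum_congr rfl fun a _ => Finset.sum_congr rfl fun b _ => ?_
  ring

end GramChannel

open scoped NNReal

theorem position_isShiftGroup : IsShiftGroup position translation where
  zero := translation_zero
  add := translation_add
  adjoint := adjoint_translation
  shift := position_translation

/-! ### The Gaussian implementation and its error. -/

section Implementation

open scoped Matrix.Norms.L2Operator

variable {n : Type*} [Fintype n] [DecidableEq n]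
variable {AS : Matrix n n ℂ} {a : n → ℝ} {P : n → Matrix n n ℂ}

theorem exists_covariantExtension_eq_exp (hP : IsSpectralFamily AS a P)
    {US : Matrix n n ℂ} (hUS : US ∈ Matrix.unitaryGroup n ℂ) :
    ∃ (τ : ℝ) (K : Composite n LineL2 →L[ℂ] Composite n LineL2), 0 < τ ∧ IsSelfAdjoint K ∧
      CommutesWith K (totalCharge AS position) ∧
      covariantExtension a P translation US =
        NormedSpace.exp ((-(Complex.I * (τ : ℂ))) • K) := by
  obtain ⟨M, hM, hexp⟩ := exists_isSelfAdjoint_exp_eq (u := US) hUS (Matrix.finite_spectrum US)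
  -- Here `US = e^{iM}` while the evolution is `e^{-iτK}`; hence `τ = 1` and the sign of `-M`.
  refine ⟨1, covariantExtension a P translation (-M), one_pos,
    isSelfAdjoint_covariantExtension (Matrix.IsHermitian.neg hM),
    commutesWith_covariantExtension hP position_isShiftGroup _, ?_⟩
  let _ : NormedAlgebra ℚ (Matrix n n ℂ) := NormedAlgebra.restrictScalars ℚ ℂ _
  let _ : NormedAlgebra ℚ (Composite n LineL2 →L[ℂ] Composite n LineL2) :=
    NormedAlgebra.restrictScalars ℚ ℂ _
  have hc : Continuous (covariantExtensionHom hP position_isShiftGroup) :=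
    (covariantExtensionHom hP position_isShiftGroup).toLinearMap.continuous_of_finiteDimensional
  rw [← hexp, ← covariantExtension_smul, ← covariantExtensionHom_apply hP position_isShiftGroup,
    ← covariantExtensionHom_apply hP position_isShiftGroup, NormedSpace.map_exp _ hc]
  congr 2
  simp

/-- The implementation of `US` with the external system in a Gaussian pure state of variance
`v`. -/
def gaussianImplementation (hP : IsSpectralFamily AS a P) {US : Matrix n n ℂ}
    (hUS : US ∈ Matrix.unitaryGroup n ℂ) {v : ℝ≥0} (hv : v ≠ 0) : ImplementationSet AS where
  HE := LineL2
  AE := position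
  dense_domain := dense_position_domain
  selfAdjoint := position_isSelfAdjoint
  ρE := InnerProductSpace.rankOne ℂ (gaussianVector v) (gaussianVector v)
  isDensityOperator := isDensityOperator_rankOne (norm_gaussianVector hv)
  U := covariantExtension a P translation US
  generated := exists_covariantExtension_eq_exp hP hUS

theorem channel_gaussianImplementation (hP : IsSpectralFamily AS a P) {US : Matrix n n ℂ}
    (hUS : US ∈ Matrix.unitaryGroup n ℂ) {v : ℝ≥0} (hv : v ≠ 0) (X : Matrix n n ℂ) :
    USᴴ * (gaussianImplementation hP hUS hv).channel X * US =
      gramChannel (fun p : n × n => translation (a p.2 - a p.1) (gaussianVector v))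
        (fun p => USᴴ * P p.1 * US * P p.2) X := by
  have h : (gaussianImplementation hP hUS hv).channel X =
      ∑ α : n × n, ∑ β : n × n, inner ℂ (translation (a β.2 - a β.1) (gaussianVector v))
        (translation (a α.2 - a α.1) (gaussianVector v)) •
        (P α.1 * US * P α.2 * X * (P β.1 * US * P β.2)ᴴ) := by
    change partialTrace (covariantExtension a P translation US ∘L tensorOp X
      (InnerProductSpace.rankOne ℂ (gaussianVector v) (gaussianVector v)) ∘L
      ContinuousLinearMap.adjoint (covariantExtension a P translation US)) = _
    rw [covariantExtension_eq_sum hP position_isShiftGroup, partialTrace_conj_rankOne]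
  rw [h, gramChannel_apply, Finset.mul_sum, Finset.sum_mul]
  refine Finset.sum_congr rfl fun α _ => ?_
  rw [Finset.mul_sum, Finset.sum_mul]
  refine Finset.sum_congr rfl fun β _ => ?_
  rw [Matrix.mul_smul, Matrix.smul_mul]
  congr 1
  simp only [Matrix.conjTranspose_mul, Matrix.conjTranspose_conjTranspose, mul_assoc]

theorem one_sub_le_entanglementFidelity (hAS : AS.IsHermitian) (hP : IsSpectralFamily AS a P)
    {US : Matrix n n ℂ} (hUS : US ∈ Matrix.unitaryGroup n ℂ) {v : ℝ≥0} (hv : v ≠ 0)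
    (ρ : DensityMatrix n) :
    1 - asymmetry AS US ^ 2 / (8 * v) ≤ entanglementFidelity ρ
      fun X => USᴴ * (gaussianImplementation hP hUS hv).channel X * US := by
  obtain ⟨c, hc⟩ := norm_sub_midpoint_le_asymmetry (U := US) hAS
  simp only [channel_gaussianImplementation]
  rw [entanglementFidelity_gramChannel]
  have hv' : (v : ℝ) ≠ 0 := by exact_mod_cast hv
  have hQ := (hP.conj hUS).sub_smul_one c
  -- `(4 v)⁻¹` is the momentum variance of the Gaussian: it turns `e^{-σ² x²/2}` into the overlap
  -- `e^{-x²/(8v)}`.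
  have h1 := one_sub_le_re_sum_mul_exp Finset.univ
    (fun p : n × n => (ρ.mat * (USᴴ * P p.1 * US * P p.2)).trace)
    (fun p => a p.2 - (a p.1 - c)) (asymmetry AS US ^ 2 / 2) (4 * v)⁻¹ (fun p => by
      refine le_trans ?_ ((hP.one_sub_le_re_sum hQ ρ p).trans_eq ?_)
      · rw [sub_right_comm] at hc
        gcongr
      · rw [Fintype.sum_prod_type])
  set Ξ := ∑ p : n × n, (ρ.mat * (USᴴ * P p.1 * US * P p.2)).trace •
    translation (a p.2 - a p.1) (gaussianVector v)
  -- Testing against the Gaussian displaced by `-c` realizes the recentring of `US† AS US` by `c`.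
  have h2 : inner ℂ (translation (-c) (gaussianVector v)) Ξ =
      ∑ p : n × n, (ρ.mat * (USᴴ * P p.1 * US * P p.2)).trace *
        Complex.exp (-(((4 * v)⁻¹ : ℝ≥0) * (a p.2 - (a p.1 - c) : ℝ) ^ 2 / 2)) := by
    rw [inner_sum]
    refine Finset.sum_congr rfl fun p _ => ?_
    rw [inner_smul_right, inner_translation_gaussianVector hv, Complex.ofReal_exp]
    congr 2
    have : (v : ℂ) ≠ 0 := by exact_mod_cast hv
    push_cast
    field_simp
    ring
  rw [← h2] at h1
  have h3 : (inner ℂ (translation (-c) (gaussianVector v)) Ξ).re ≤ ‖Ξ‖ := by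
    refine (Complex.re_le_norm _).trans ((norm_inner_le_norm _ _).trans ?_)
    rw [norm_translation, norm_gaussianVector hv, one_mul]
  refine le_trans (le_of_eq ?_) (h1.trans h3)
  push_cast
  field_simp
  ring

theorem error_gaussianImplementation_le (hAS : AS.IsHermitian) (hP : IsSpectralFamily AS a P)
    {US : Matrix n n ℂ} (hUS : US ∈ Matrix.unitaryGroup n ℂ) {v : ℝ≥0} (hv : v ≠ 0) {δ : ℝ}
    (hδ : 0 ≤ δ) (h : asymmetry AS US ^ 2 / (4 * v) ≤ δ ^ 2) :
    (gaussianImplementation hP hUS hv).error US ≤ δ := by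
  refine Real.iSup_le (fun ρ => ?_) hδ
  refine Real.sqrt_le_iff.2 ⟨hδ, ?_⟩
  have h1 := one_sub_le_entanglementFidelity hAS hP hUS hv ρ
  have h2 : asymmetry AS US ^ 2 / (4 * v) = 2 * (asymmetry AS US ^ 2 / (8 * v)) := by ring
  linarith

end Implementation

end CoherenceCost

end

theorem theorem2 {n : Type*} [Fintype n] [DecidableEq n]
    (AS US : Matrix n n ℂ) (hAS : AS.IsHermitian) (hUS : US ∈ Matrix.unitaryGroup n ℂ)
    (δ : ℝ) (hδ : 0 < δ)
    (hδ' : δ ≤ 4 * Real.sqrt 2 * CoherenceCost.asymmetry AS US / (9 * CoherenceCost.opNorm AS))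
    (F : ℝ)
    (hF : CoherenceCost.asymmetry AS US / δ + Real.sqrt 2 * CoherenceCost.opNorm AS
      ≤ Real.sqrt F) :
    ∃ I : CoherenceCost.ImplementationSet AS,
      I.error US ≤ δ ∧
      CoherenceCost.IsFisherInformation I.AE I.ρE (ENNReal.ofReal F) := by
  open CoherenceCost in
  have hA : 0 ≤ opNorm AS := norm_nonneg _
  -- The two bounds on `δ` force positive asymmetry, hence `F > 0` and a nondegenerate Gaussian.
  have hasym : 0 < asymmetry AS US := by
    by_contra! h
    refine absurd (hδ.trans_le hδ') (not_lt.2 (div_nonpos_of_nonpos_of_nonneg ?_ (by positivity)))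
    exact mul_nonpos_of_nonneg_of_nonpos (by positivity) h
  have hle : asymmetry AS US / δ ≤ √F := le_trans (le_add_of_nonneg_right (by positivity)) hF
  have hF0 : 0 < F := Real.sqrt_pos.1 ((div_pos hasym hδ).trans_le hle)
  obtain ⟨a, P, hP⟩ := exists_isSpectralFamily hAS
  -- The variance is `F / 4` because the Fisher information of a pure state is four times its
  -- variance.
  have hv : (F / 4).toNNReal ≠ 0 := by
    rw [Ne, Real.toNNReal_eq_zero, not_le]
    positivity
  refine ⟨gaussianImplementation hP hUS hv,
    error_gaussianImplementation_le hAS hP hUS hv hδ.le ?_, ?_⟩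
  · rw [Real.coe_toNNReal _ (by positivity), mul_div_cancel₀ _ four_ne_zero, div_le_iff₀ hF0,
      ← Real.sq_sqrt hF0.le, ← mul_pow]
    rw [div_le_iff₀ hδ] at hle
    exact pow_le_pow_left₀ hasym.le (by linarith) 2
  · have h := isFisherInformation_rankOne position (norm_gaussianVector hv)
    rw [variance_gaussianVector hv] at h
    have e : (4 : ENNReal) * ((F / 4).toNNReal : ENNReal) = ENNReal.ofReal F := by
      rw [← ENNReal.ofReal, ← ENNReal.ofReal_ofNat, ← ENNReal.ofReal_mul (by norm_num)]
      congr 1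
      ring
    rw [e] at h
    exact h
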